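/- Let $\{X_{ij}\}_{(i,j)\in\mathbb Z^2}$ be a zero-mean stationary Gaussian random field following the symmetric first-order conditional autoregression (SFCAR): for parameters $\kappa>0$ and $\lambda\ge 0$ with $\zeta=\lambda/\kappa\in[0,1/4)$, and for all $(i,j)$, given all the other variables $\mathcal X_{-ij}$, the variable $X_{ij}$ has conditional mean $$\mathbb E\{X_{ij}\mid \mathcal X_{-ij}\}=\frac{\lambda}{\kappa}\,(X_{i+1,j}+X_{i-1,j}+X_{i,j+1}+X_{i,j-1})$$ and conditional variance $1/\kappa$. The value $\zeta=1/4$ of the edge dependence factor stands for the perfectly correlated zero-mean Gaussian field, in which $X_{ij}=X_{i'j'}$ almost surely for all indices. Let $\{W_{ij}\}$ be i.i.d. $\mathcal N(0,\sigma^2)$ with $\sigma^2>0$, independent of $\{X_{ij}\}$. Put $\mathcal I_n=\{0,\dots,n-1\}^2$ and $\mathrm{SNR}=\mathbb E\{X_{ij}^2\}/\mathbb E\{W_{ij}^2\}$, and let $$K(k)=\int_0^{\pi/2}\frac{d\theta}{\sqrt{1-k^2\sin^2\theta}}$$ be the complete elliptic integral of the first kind with modulus $k$, where $K(1)=\infty$.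 Let $p_{0,n}$ and $p_{1,n}$ be the probability densities of the samples $\{Y_{ij},(i,j)\in\mathcal I_n\}$ under the hypotheses $Y_{ij}=W_{ij}$ and $Y_{ij}=X_{ij}+W_{ij}$, respectively. Then, with $$g(\omega_1,\omega_2)=\frac{\mathrm{SNR}}{(2/\pi)K(4\zeta)\,(1-2\zeta\cos\omega_1-2\zeta\cos\omega_2)}$$ (which is $0$ for $\zeta=1/4$ and almost every $(\omega_1,\omega_2)$), the following limits exist and have the stated values. (1) The asymptotic per-node Kullback–Leibler information $$\mathcal K_s=\lim_{n\to\infty}\frac1{|\mathcal I_n|}\log\frac{p_{0,n}}{p_{1,n}}\big(\{Y_{ij},(i,j)\in\mathcal I_n\}\big)\qquad\text{almost surely under the hypothesis } Y_{ij}=W_{ij}$$ equals $$\mathcal K_s=\frac1{4\pi^2}\int_{-\pi}^{\pi}\int_{-\pi}^{\pi}\left[\frac12\log\big(1+g(\omega_1,\omega_2)\big)-\frac12\left(1-\frac1{1+g(\omega_1,\omega_2)}\right)\right]d\omega_1\,d\omega_2 .$$ (2) For $Y_{ij}=X_{ij}+W_{ij}$, the mutual information $I(\{X_{ij}\}_{\mathcal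 I_n};\{Y_{ij}\}_{\mathcal I_n})$ is finite for every $n$, and the asymptotic per-node mutual information $\mathcal I_s=\lim_{n\to\infty}\frac1{|\mathcal I_n|}I(\{X_{ij}\}_{\mathcal I_n};\{Y_{ij}\}_{\mathcal I_n})$ equals $$\mathcal I_s=\frac1{4\pi^2}\int_{-\pi}^{\pi}\int_{-\pi}^{\pi}\frac12\log\big(1+g(\omega_1,\omega_2)\big)\,d\omega_1\,d\omega_2 .$$ -/

import Mathlib

open MeasureTheory ProbabilityTheory InformationTheory Filter Topology
open scoped ENNReal NNReal

noncomputable section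

/-- A (real) random field on the infinite two-dimensional lattice `ℤ × ℤ`. -/
abbrev LatticeField (Ω : Type*) : Type _ := ℤ × ℤ → Ω → ℝ

/-- The restriction of a configuration on `ℤ × ℤ` to the `n × n` box
`{(i, j) : 0 ≤ i, j ≤ n - 1}`. -/
def boxRestrict (n : ℕ) (y : ℤ × ℤ → ℝ) : Fin n × Fin n → ℝ :=
  fun p ↦ y ((p.1.val : ℤ), (p.2.val : ℤ))

/-- The random configuration `ω ↦ (X i ω)_i` of a random field. -/
def fieldConfig {Ω : Type*} (X : LatticeField Ω) : Ω → (ℤ × ℤ → ℝ) :=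
  fun ω i ↦ X i ω

/-- The sigma-algebra generated by all the variables `X j` with `j ≠ i`. -/
abbrev othersSigma {Ω : Type*} (X : LatticeField Ω) (i : ℤ × ℤ) : MeasurableSpace Ω :=
  ⨆ j : {j : ℤ × ℤ // j ≠ i}, MeasurableSpace.comap (X j.1) inferInstance

/-- A zero-mean Gaussian random field on the lattice which is (second order) stationary: the
covariance of `X i` and `X j` depends only on the difference of the indices. -/
structure IsStationaryGaussianField {Ω : Type*} [MeasurableSpace Ω] (X : LatticeField Ω)
    (μ : Measure Ω) : Prop where
  measurable : ∀ i, Measurable (X i)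
  gaussian : IsGaussianProcess X μ
  zero_mean : ∀ i, ∫ ω, X i ω ∂μ = 0
  stationary : ∀ i j h, cov[X (i + h), X (j + h); μ] = cov[X i, X j; μ]

/-- The symmetric first-order conditional autoregression with parameters `κ` and `lam`: a zero-mean
stationary Gaussian field in which, given all the other variables, `X (i, j)` has conditional mean
`(lam / κ) * (X (i+1, j) + X (i-1, j) + X (i, j+1) + X (i, j-1))` and conditional precision (inverse
conditional variance) `κ`. -/
structure IsSFCAR {Ω : Type*} [MeasurableSpace Ω] (X : LatticeField Ω) (κ lam : ℝ)
    (μ : Measure Ω) : Prop where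
  field : IsStationaryGaussianField X μ
  cond_mean : ∀ i j : ℤ, μ[X (i, j) | othersSigma X (i, j)] =ᵐ[μ]
    fun ω ↦ (lam / κ) * (X (i + 1, j) ω + X (i - 1, j) ω + X (i, j + 1) ω + X (i, j - 1) ω)
  cond_precision : ∀ i j : ℤ, Var[X (i, j); μ | othersSigma X (i, j)] =ᵐ[μ] fun _ ↦ κ⁻¹

/-- The perfectly correlated zero-mean Gaussian field: all its variables coincide almost surely. -/
structure IsPerfectlyCorrelated {Ω : Type*} [MeasurableSpace Ω] (X : LatticeField Ω)
    (μ : Measure Ω) : Prop where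
  field : IsStationaryGaussianField X μ
  eq : ∀ i j, X i =ᵐ[μ] X j

/-- `X` is a two-dimensional SFCAR signal with edge dependence factor `ζ = lam / κ ∈ [0, 1/4]`.
For `lam = κ / 4` with a finite `κ` the spectral density `1 / (4π²κ(1 - 2ζ cos ω₁ - 2ζ cos ω₂))` is
not integrable and no field of finite power satisfies the conditional specification; the value
`ζ = 1/4` stands for the perfectly correlated field. -/
def IsSFCARSignal {Ω : Type*} [MeasurableSpace Ω] (X : LatticeField Ω) (ζ : ℝ)
    (μ : Measure Ω) : Prop :=
  (∃ κ lam : ℝ, 0 < κ ∧ 0 ≤ lam ∧ lam < κ / 4 ∧ ζ = lam / κ ∧ IsSFCAR X κ lam μ) ∨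
    (ζ = 1 / 4 ∧ IsPerfectlyCorrelated X μ)

/-- The hidden SFCAR model: the signal `X` is an SFCAR field with edge dependence factor `ζ`, the
measurement noise `W` is i.i.d. `N(0, σ2)` and independent of the signal field. -/
structure IsHiddenSFCAR {Ω : Type*} [MeasurableSpace Ω] (X W : LatticeField Ω) (ζ : ℝ) (σ2 : ℝ≥0)
    (μ : Measure Ω) : Prop where
  signal : IsSFCARSignal X ζ μ
  noise_measurable : ∀ i, Measurable (W i)
  noise_law : ∀ i, HasLaw (W i) (gaussianReal 0 σ2) μ
  noise_indep : iIndepFun W μ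
  signal_indep_noise : IndepFun (fieldConfig X) (fieldConfig W) μ

/-- The probability density (with respect to Lebesgue measure) of the samples in the `n × n` box,
when the whole field has law `Q`. -/
def boxDensity (Q : Measure (ℤ × ℤ → ℝ)) (n : ℕ) (y : Fin n × Fin n → ℝ) : ℝ :=
  ((Q.map (boxRestrict n)).rnDeriv volume y).toReal

/-- `r` is the asymptotic per-node Kullback-Leibler information between the null law `Q₀` and the
alternative law `Q₁` of the observed field: the normalized log-likelihood ratio
`(1 / n²) log (p₀ / p₁)` of the samples in the `n × n` box converges to `r`, `Q₀`-almost surely. -/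
def HasKLIRate (Q₀ Q₁ : Measure (ℤ × ℤ → ℝ)) (r : ℝ) : Prop :=
  ∀ᵐ y ∂Q₀, Tendsto
    (fun n : ℕ ↦ 1 / (n : ℝ) ^ 2 *
      Real.log (boxDensity Q₀ n (boxRestrict n y) / boxDensity Q₁ n (boxRestrict n y)))
    atTop (𝓝 r)

/-- The mutual information `I(U; V)` (in nats): the Kullback-Leibler divergence of the joint law
from the product of the marginal laws. -/
def mutualInformation {Ω α β : Type*} [MeasurableSpace Ω] [MeasurableSpace α] [MeasurableSpace β]
    (U : Ω → α) (V : Ω → β) (μ : Measure Ω) : ℝ≥0∞ :=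
  klDiv (μ.map (fun ω ↦ (U ω, V ω))) ((μ.map U).prod (μ.map V))

/-- `r` is the asymptotic per-node mutual information between the fields `X` and `Y`: for every `n`
the mutual information `I_n` between their samples in the `n × n` box is finite, and
`I_n / n²` converges to `r`. -/
def HasMIRate {Ω : Type*} [MeasurableSpace Ω] (X Y : LatticeField Ω) (μ : Measure Ω)
    (r : ℝ) : Prop :=
  (∀ n : ℕ, mutualInformation (fun ω ↦ boxRestrict n (fieldConfig X ω))
    (fun ω ↦ boxRestrict n (fieldConfig Y ω)) μ ≠ ∞) ∧
  Tendsto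
    (fun n : ℕ ↦ 1 / (n : ℝ) ^ 2 *
      (mutualInformation (fun ω ↦ boxRestrict n (fieldConfig X ω))
        (fun ω ↦ boxRestrict n (fieldConfig Y ω)) μ).toReal)
    atTop (𝓝 r)

/-- The signal-to-noise ratio `E[X²] / E[W²]` (at the origin; by stationarity it is the same
at every node). -/
def signalToNoise {Ω : Type*} [MeasurableSpace Ω] (X W : LatticeField Ω) (μ : Measure Ω) : ℝ :=
  (∫ ω, X (0, 0) ω ^ 2 ∂μ) / (∫ ω, W (0, 0) ω ^ 2 ∂μ)

/-- The complete elliptic integral of the first kind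
`K(k) = ∫_0^{π/2} dθ / √(1 - k² sin² θ)` as a function of the modulus `k ∈ [0, 1]`, with values in
`[0, ∞]`; thus `K(1) = ∞`. -/
def ellipticK (k : ℝ) : ℝ≥0∞ :=
  ∫⁻ θ in Set.Ioo (0 : ℝ) (Real.pi / 2), ENNReal.ofReal (1 / √(1 - k ^ 2 * Real.sin θ ^ 2))

/-- The quotient `SNR / ((2/π) K(4ζ) (1 - 2ζ cos ω₁ - 2ζ cos ω₂))`. It is computed in `[0, ∞]`, so
that it vanishes for `ζ = 1/4`, where `K(4ζ) = ∞`, at every `(ω₁, ω₂)` with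
`cos ω₁ + cos ω₂ ≠ 2`. -/
def snrQuotient (snr ζ ω₁ ω₂ : ℝ) : ℝ :=
  (ENNReal.ofReal snr / (ENNReal.ofReal (2 / Real.pi) * ellipticK (4 * ζ) *
    ENNReal.ofReal (1 - 2 * ζ * Real.cos ω₁ - 2 * ζ * Real.cos ω₂))).toReal

end

/-! Let `C` be the covariance kernel of the signal. Pulling `X q` out of the conditional expectation
of `X p` for `q ≠ p`, and using the conditional variance for `q = p`, gives `(1 - ζ A) C = κ⁻¹ δ` on
the lattice, with `A` the nearest-neighbour adjacency (`IsSFCAR.fieldCov_eq`). So no spectral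
representation of the field is needed: `C` is a Green function, and its restriction to the box is
compared with the Green function of the box itself, `κ⁻¹ (gridMatrix ζ n)⁻¹`. The two differ only
through boundary nodes, hence by `O(n)` in entrywise ℓ¹ norm (`sum_abs_boxMatrix_sub_le`).

The observation has covariance `σ² B` with `B = 1 + σ⁻² C ≥ 1`. For matrices `B ≥ 1`, `log det B`
and `tr B⁻¹` are 1-Lipschitz in the entrywise ℓ¹ norm, in every dimension (`abs_log_det_sub_le`,
`abs_trace_inv_sub_le`). After division by `n²` the box covariance may therefore be replaced by the
grid model, whose eigenvalues are explicit; spectral averages become Riemann sums of the symbol `1 -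
2ζ cos x - 2ζ cos y` (`tendsto_average_gridSymbol`). The same argument applied to the trace of `C`
evaluates the signal power as `κ⁻¹ (2/π) K(4ζ)` (`variance_eq_ellipticK`), which turns `1/(σ²κ)`
into the stated SNR quotient.

On the probabilistic side, orthogonal diagonalisation of `B` makes the coordinates independent. The
mutual information of the box is exactly `½ log det B` (`klDiv_eq`). Under the null hypothesis the
log-likelihood ratio is `gaussianKL B` plus a centred fluctuation of variance `O(n²)`
(`exists_log_likelihood_eq`); scaled by `n⁻²` its variances are summable, which gives almost sure
convergence. For `ζ = 1/4` the signal covariance has rank at most one, so both quantities are `O(log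
n)` and the rates vanish. -/

/-! ### Dimension-free perturbation bounds for `log det` and the trace of the inverse -/

section MatrixComparison

open Matrix
open scoped MatrixOrder

variable {ι : Type*} [Fintype ι] [DecidableEq ι]

theorem log_det_le_trace_sub_card {C : Matrix ι ι ℝ} (hC : C.PosDef) :
    Real.log C.det ≤ C.trace - Fintype.card ι := by
  have h := hC.isHermitian
  have hpos := h.posDef_iff_eigenvalues_pos.1 hC
  rw [h.det_eq_prod_eigenvalues, h.trace_eq_sum_eigenvalues]
  simp only [RCLike.ofReal_real_eq_id, id_eq]
  rw [Real.log_prod (fun i _ ↦ (hpos i).ne')]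
  calc ∑ i, Real.log (h.eigenvalues i) ≤ ∑ i, (h.eigenvalues i - 1) :=
        Finset.sum_le_sum fun i _ ↦ Real.log_le_sub_one_of_pos (hpos i)
    _ = _ := by simp

/-- Concavity of `log det`, as a tangent inequality at `B`. Factor `B⁻¹ = Sᴴ S`; the matrix `S B'
Sᴴ` has determinant `det B' / det B` and trace `tr (B⁻¹ B')`, and `log x ≤ x - 1` applies to its
eigenvalues. -/
theorem log_det_sub_log_det_le {B B' : Matrix ι ι ℝ} (hB : B.PosDef) (hB' : B'.PosDef) :
    Real.log B'.det - Real.log B.det ≤ (B⁻¹ * (B' - B)).trace := by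
  obtain ⟨S, hS⟩ := CStarAlgebra.nonneg_iff_eq_star_mul_self.mp hB.inv.posSemidef.nonneg
  rw [Matrix.star_eq_conjTranspose] at hS
  have hSu : IsUnit S := by
    rw [Matrix.isUnit_iff_isUnit_det]
    have h : IsUnit (Sᴴ * S).det := hS ▸ hB.inv.det_pos.ne'.isUnit
    rw [Matrix.det_mul] at h
    exact isUnit_of_mul_isUnit_right h
  have hC : (S * B' * Sᴴ).PosDef :=
    (Matrix.IsUnit.posDef_star_right_conjugate_iff hSu).2 hB'
  have hdet : (S * B' * Sᴴ).det = B'.det / B.det := by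
    rw [Matrix.det_mul_right_comm, Matrix.det_mul, ← Matrix.det_mul_comm, ← hS,
      Matrix.det_nonsing_inv, Ring.inverse_eq_inv', div_eq_inv_mul]
  have htr : (S * B' * Sᴴ).trace = (B⁻¹ * B').trace := by
    rw [Matrix.trace_mul_comm, ← Matrix.mul_assoc, ← hS]
  have h := log_det_le_trace_sub_card hC
  rw [hdet, htr, Real.log_div hB'.det_pos.ne' hB.det_pos.ne'] at h
  rw [Matrix.mul_sub, Matrix.trace_sub, Matrix.nonsing_inv_mul _ hB.det_pos.ne'.isUnit,
    Matrix.trace_one]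
  exact h

/-- Testing `B ≥ 1` against `v` gives `v ⬝ᵥ v ≤ v q`, while `(v q)² ≤ v ⬝ᵥ v`; hence `v q ≤ 1`. This
bounds the columns of `B⁻¹` without operator norms. -/
theorem dotProduct_self_le_one_of_mulVec {B : Matrix ι ι ℝ} (hB : (B - 1).PosSemidef) {v : ι → ℝ} {q : ι}
    (hv : B *ᵥ v = Pi.single q 1) : v ⬝ᵥ v ≤ 1 := by
  have h := hB.dotProduct_mulVec_nonneg v
  rw [sub_mulVec, one_mulVec, hv, dotProduct_sub] at h
  simp at h
  have h1 : v q ^ 2 ≤ v ⬝ᵥ v := by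
    rw [dotProduct, pow_two]
    exact Finset.single_le_sum (f := fun i ↦ v i * v i) (fun i _ ↦ mul_self_nonneg _) (Finset.mem_univ q)
  nlinarith

theorem inv_col_dotProduct_self_le_one {B : Matrix ι ι ℝ} (hB : B.PosDef) (hB1 : (B - 1).PosSemidef) (q : ι) :
    (∑ p, B⁻¹ p q ^ 2) ≤ 1 := by
  have := dotProduct_self_le_one_of_mulVec hB1 (v := fun p ↦ B⁻¹ p q) (q := q) (by
    have h : B * B⁻¹ = 1 := B.mul_nonsing_inv hB.det_pos.ne'.isUnit
    ext p
    have := congrFun (congrFun h p) q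
    simp [Matrix.mul_apply] at this
    simp [mulVec, dotProduct, this, Matrix.one_apply, Pi.single_apply])
  simpa [dotProduct, pow_two] using this

theorem abs_inv_apply_le_one {B : Matrix ι ι ℝ} (hB : B.PosDef) (hB1 : (B - 1).PosSemidef) (p q : ι) :
    |B⁻¹ p q| ≤ 1 := by
  rw [abs_le_one_iff_mul_self_le_one, ← pow_two]
  exact (Finset.single_le_sum (f := fun i ↦ B⁻¹ i q ^ 2) (fun i _ ↦ sq_nonneg _)
    (Finset.mem_univ p)).trans (inv_col_dotProduct_self_le_one hB hB1 q)

omit [DecidableEq ι] in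
theorem abs_trace_mul_le {M E : Matrix ι ι ℝ} (hM : ∀ p q, |M p q| ≤ 1) :
    |(M * E).trace| ≤ ∑ p, ∑ q, |E p q| := by
  rw [Matrix.trace_mul_comm]
  simp only [Matrix.trace, diag_apply, Matrix.mul_apply]
  refine (Finset.abs_sum_le_sum_abs _ _).trans (Finset.sum_le_sum fun p _ ↦
    (Finset.abs_sum_le_sum_abs _ _).trans (Finset.sum_le_sum fun q _ ↦ ?_))
  rw [abs_mul]
  exact mul_le_of_le_one_right (abs_nonneg _) (hM _ _)

/-- The tangent inequality is used at `B` and at `B'`; in both cases the inverse has entries of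
absolute value at most 1. -/
theorem abs_log_det_sub_le {B B' : Matrix ι ι ℝ} (hB : B.PosDef) (hB1 : (B - 1).PosSemidef)
    (hB' : B'.PosDef) (hB1' : (B' - 1).PosSemidef) :
    |Real.log B'.det - Real.log B.det| ≤ ∑ p, ∑ q, |(B' - B) p q| := by
  rw [abs_le']
  constructor
  · exact (log_det_sub_log_det_le hB hB').trans ((le_abs_self _).trans
      (abs_trace_mul_le (abs_inv_apply_le_one hB hB1)))
  · have := (log_det_sub_log_det_le hB' hB).trans ((le_abs_self _).trans
      (abs_trace_mul_le (abs_inv_apply_le_one hB' hB1')))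
    simp only [Matrix.sub_apply, abs_sub_comm (B _ _)] at this ⊢
    linarith

/-- By the resolvent identity the difference is the trace of `B'⁻¹ B⁻¹ (B' - B)`. The entries of
`B'⁻¹ B⁻¹` are at most 1 by Cauchy–Schwarz, since rows of the symmetric `B'⁻¹` are columns. -/
theorem abs_trace_inv_sub_le {B B' : Matrix ι ι ℝ} (hB : B.PosDef) (hB1 : (B - 1).PosSemidef)
    (hB' : B'.PosDef) (hB1' : (B' - 1).PosSemidef) :
    |B⁻¹.trace - B'⁻¹.trace| ≤ ∑ p, ∑ q, |(B' - B) p q| := by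
  have h : B⁻¹ - B'⁻¹ = B⁻¹ * (B' - B) * B'⁻¹ := by
    rw [Matrix.mul_sub, Matrix.sub_mul, Matrix.nonsing_inv_mul _ hB.det_pos.ne'.isUnit,
      Matrix.mul_assoc, Matrix.mul_nonsing_inv _ hB'.det_pos.ne'.isUnit]
    simp
  rw [← Matrix.trace_sub, h, Matrix.trace_mul_comm, ← Matrix.mul_assoc]
  refine abs_trace_mul_le fun p q ↦ ?_
  rw [abs_le_one_iff_mul_self_le_one, ← pow_two, Matrix.mul_apply]
  refine (Finset.sum_mul_sq_le_sq_mul_sq _ _ _).trans ?_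
  have hs : ∀ s, B'⁻¹ p s = B'⁻¹ s p := fun s ↦ by
    have := hB'.isHermitian.inv.apply s p
    simpa using this
  simp_rw [hs]
  exact mul_le_one₀ (inv_col_dotProduct_self_le_one hB' hB1' p) (Finset.sum_nonneg fun _ _ ↦ sq_nonneg _)
    (inv_col_dotProduct_self_le_one hB hB1 q)

end MatrixComparison

/-! ### Explicit diagonalisation of the grid model by sines -/

section GridMatrix

open Matrix
open scoped Kronecker

/-- The adjacency matrix of the path with `n` vertices. -/
def pathAdjacency (n : ℕ) : Matrix (Fin n) (Fin n) ℝ :=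
  Matrix.of fun i j ↦ (if j.val = i.val + 1 then 1 else 0) + (if i.val = j.val + 1 then 1 else 0)

theorem pathAdjacency_nonneg {n : ℕ} (i j : Fin n) : 0 ≤ pathAdjacency n i j := by
  simp only [pathAdjacency, Matrix.of_apply]; positivity

theorem pathAdjacency_comm {n : ℕ} (i j : Fin n) : pathAdjacency n i j = pathAdjacency n j i := by
  simp only [pathAdjacency, Matrix.of_apply]; ring

/-- Taking `F` on all of `ℤ` makes visible which neighbours the path loses at its two ends. -/
theorem sum_pathAdjacency_mul {n : ℕ} (i : Fin n) (F : ℤ → ℝ) :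
    ∑ j : Fin n, pathAdjacency n i j * F j =
      (if i.val + 1 < n then F (i + 1) else 0) + (if 0 < i.val then F (i - 1) else 0) := by
  simp only [pathAdjacency, Matrix.of_apply, add_mul, Finset.sum_add_distrib, ite_mul, one_mul,
    zero_mul]
  congr 1
  · split_ifs with h
    · rw [Finset.sum_eq_single ⟨i.val + 1, h⟩]
      · simp
      · intro b _ hb
        rw [if_neg]
        exact fun h' ↦ hb (Fin.ext h')
      · simp
    · refine Finset.sum_eq_zero fun j _ ↦ if_neg ?_
      have := j.2
      omega
  · split_ifs with h
    · rw [Finset.sum_eq_single ⟨i.val - 1, by omega⟩]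
      · rw [if_pos (by simp; omega)]
        congr 1
        simp; omega
      · intro b _ hb
        rw [if_neg]
        exact fun h' ↦ hb (Fin.ext (by simp; omega))
      · simp
    · refine Finset.sum_eq_zero fun j _ ↦ if_neg ?_
      omega

theorem sum_pathAdjacency_le {n : ℕ} (i : Fin n) : ∑ j : Fin n, pathAdjacency n i j ≤ 2 := by
  have := sum_pathAdjacency_mul i (fun _ ↦ 1)
  simp only [mul_one] at this
  rw [this]
  split_ifs <;> norm_num

/-- The angle `π (j + 1) / (n + 1)`. -/
noncomputable def gridAngle (n j : ℕ) : ℝ := ((j : ℝ) + 1) * Real.pi / ((n : ℝ) + 1)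

theorem gridAngle_mem {n : ℕ} (j : Fin n) : gridAngle n j ∈ Set.Ioo 0 Real.pi := by
  have h : ((j : ℕ) : ℝ) + 1 ≤ n := by exact_mod_cast j.2
  have hn : (0 : ℝ) < (n : ℝ) + 1 := by positivity
  unfold gridAngle
  refine ⟨by positivity, ?_⟩
  rw [div_lt_iff₀ hn]
  nlinarith [Real.pi_pos]

/-- The matrix of the eigenvectors of `pathAdjacency n`. -/
noncomputable def sineMatrix (n : ℕ) : Matrix (Fin n) (Fin n) ℝ :=
  Matrix.of fun k j ↦ Real.sin ((((k : ℕ) : ℝ) + 1) * gridAngle n j)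

/-- The sum formula for `sin ((k + 1) θ ± θ)`. The neighbours missing at the ends do no harm,
because `sin (m θ)` vanishes at `m = 0` and, for these angles, at `m = n + 1`. -/
theorem pathAdjacency_mul_sineMatrix (n : ℕ) :
    pathAdjacency n * sineMatrix n =
      sineMatrix n * diagonal fun j : Fin n ↦ 2 * Real.cos (gridAngle n j) := by
  ext k j
  rw [Matrix.mul_diagonal, Matrix.mul_apply]
  have h := sum_pathAdjacency_mul k (fun l : ℤ ↦ Real.sin (((l : ℝ) + 1) * gridAngle n j))
  simp only [Int.cast_natCast] at h
  simp only [sineMatrix, Matrix.of_apply]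
  rw [h]
  have hadd : Real.sin ((((k : ℕ) : ℝ) + 1 + 1) * gridAngle n j) +
      Real.sin (((k : ℕ) : ℝ) * gridAngle n j) =
      Real.sin ((((k : ℕ) : ℝ) + 1) * gridAngle n j) * (2 * Real.cos (gridAngle n j)) := by
    have h1 : (((k : ℕ) : ℝ) + 1 + 1) * gridAngle n j =
      (((k : ℕ) : ℝ) + 1) * gridAngle n j + gridAngle n j := by ring
    have h2 : ((k : ℕ) : ℝ) * gridAngle n j =
      (((k : ℕ) : ℝ) + 1) * gridAngle n j - gridAngle n j := by ring
    rw [h1, h2, Real.sin_add, Real.sin_sub]; ring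
  rw [← hadd]
  push_cast
  congr 1
  · split_ifs with hk
    · rfl
    · have hk' : (n : ℝ) = ((k : ℕ) : ℝ) + 1 := by
        have := k.2
        exact_mod_cast (by omega : n = k.val + 1)
      rw [← hk']
      have : ((n : ℝ) + 1) * gridAngle n j = ((j.val + 1 : ℕ) : ℝ) * Real.pi := by
        unfold gridAngle
        field_simp
        push_cast; ring
      rw [this, Real.sin_nat_mul_pi]
  · split_ifs with hk
    · congr 2; ring
    · have : k.val = 0 := by omega
      simp [this]

/-- Cosine is injective on `[0, π]`, so the columns are eigenvectors for distinct eigenvalues; they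
are nonzero because their first entry is `sin θ > 0`. -/
theorem isUnit_sineMatrix (n : ℕ) : IsUnit (sineMatrix n) := by
  rw [← linearIndependent_cols_iff_isUnit]
  refine Module.End.eigenvectors_linearIndependent' (Matrix.toLin' (pathAdjacency n))
    (fun j : Fin n ↦ 2 * Real.cos (gridAngle n j)) ?_ _ ?_
  · intro i j hij
    have h := Real.injOn_cos (Set.Ioo_subset_Icc_self (gridAngle_mem i))
      (Set.Ioo_subset_Icc_self (gridAngle_mem j)) (by simpa using hij)
    have hn : ((n : ℝ) + 1) ≠ 0 := by positivity
    unfold gridAngle at h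
    field_simp at h
    exact Fin.ext (by exact_mod_cast (by linarith : ((i : ℕ) : ℝ) = (j : ℕ)))
  · intro j
    refine ⟨Module.End.mem_eigenspace_iff.2 ?_, ?_⟩
    · rw [Matrix.toLin'_apply]
      ext k
      have := congrFun (congrFun (pathAdjacency_mul_sineMatrix n) k) j
      rw [Matrix.mul_diagonal] at this
      rw [Pi.smul_apply, smul_eq_mul, mul_comm]
      exact this
    · intro h
      have h0 := congrFun h ⟨0, j.pos⟩
      have hs := Real.sin_pos_of_mem_Ioo (gridAngle_mem j)
      simp [sineMatrix, Matrix.col, Matrix.transpose] at h0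
      exact hs.ne' h0

/-- The matrix `1 - ζ A` with `A` the adjacency matrix of the `n × n` grid. -/
def gridMatrix (ζ : ℝ) (n : ℕ) : Matrix (Fin n × Fin n) (Fin n × Fin n) ℝ :=
  1 - ζ • (pathAdjacency n ⊗ₖ (1 : Matrix (Fin n) (Fin n) ℝ) + (1 : Matrix (Fin n) (Fin n) ℝ) ⊗ₖ pathAdjacency n)

/-- The eigenvalues of `gridMatrix ζ n`. -/
noncomputable def gridEigenvalue (ζ : ℝ) (n : ℕ) (p : Fin n × Fin n) : ℝ :=
  1 - 2 * ζ * Real.cos (gridAngle n p.1) - 2 * ζ * Real.cos (gridAngle n p.2)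

theorem gridEigenvalue_pos {ζ : ℝ} (h0 : 0 ≤ ζ) (h1 : ζ < 1 / 4) (n : ℕ) (p : Fin n × Fin n) :
    0 < gridEigenvalue ζ n p := by
  unfold gridEigenvalue
  nlinarith [Real.cos_le_one (gridAngle n p.1), Real.cos_le_one (gridAngle n p.2)]

theorem gridMatrix_mul_eigenvectors (ζ : ℝ) (n : ℕ) :
    gridMatrix ζ n * (sineMatrix n ⊗ₖ sineMatrix n) =
      (sineMatrix n ⊗ₖ sineMatrix n) * diagonal (gridEigenvalue ζ n) := by
  have hd : diagonal (gridEigenvalue ζ n) = 1 - ζ •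
      ((diagonal fun j : Fin n ↦ 2 * Real.cos (gridAngle n j)) ⊗ₖ (1 : Matrix (Fin n) (Fin n) ℝ) +
      (1 : Matrix (Fin n) (Fin n) ℝ) ⊗ₖ (diagonal fun j : Fin n ↦ 2 * Real.cos (gridAngle n j))) := by
    rw [← Matrix.diagonal_one, ← Matrix.diagonal_one, Matrix.diagonal_kronecker_diagonal,
      Matrix.diagonal_kronecker_diagonal, Matrix.diagonal_add, ← Matrix.diagonal_smul,
      Matrix.diagonal_sub]
    congr 1
    ext p
    simp [gridEigenvalue]
    ring
  rw [hd, gridMatrix, Matrix.sub_mul, Matrix.mul_sub, Matrix.one_mul, Matrix.mul_one,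
    Matrix.smul_mul, Matrix.mul_smul, Matrix.add_mul, Matrix.mul_add]
  simp only [← Matrix.mul_kronecker_mul, pathAdjacency_mul_sineMatrix, Matrix.one_mul,
    Matrix.mul_one]

theorem isUnit_gridEigenvectors (n : ℕ) : IsUnit (sineMatrix n ⊗ₖ sineMatrix n) := by
  have h := (Matrix.isUnit_iff_isUnit_det _).1 (isUnit_sineMatrix n)
  rw [Matrix.isUnit_iff_isUnit_det, Matrix.det_kronecker]
  exact (h.pow _).mul (h.pow _)

theorem gridMatrix_isHermitian (ζ : ℝ) (n : ℕ) : (gridMatrix ζ n).IsHermitian := by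
  refine Matrix.IsHermitian.ext fun p q ↦ ?_
  simp [gridMatrix, Matrix.one_apply, Matrix.kroneckerMap_apply, pathAdjacency_comm p.1 q.1,
    pathAdjacency_comm p.2 q.2, eq_comm (a := p), eq_comm (a := p.1), eq_comm (a := p.2)]

section Similarity

variable {ι : Type*} [Fintype ι] [DecidableEq ι] {M V : Matrix ι ι ℝ} {d : ι → ℝ}

/-- The sine columns are not normalised, so `V` is only invertible. Similarity suffices to read off
the spectrum, and likewise the determinant and the trace below. -/
theorem Matrix.IsHermitian.posDef_of_similar_diagonal (hM : M.IsHermitian) (hV : IsUnit V)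
    (h : M * V = V * diagonal d) (hd : ∀ i, 0 < d i) : M.PosDef := by
  rw [hM.posDef_iff_eigenvalues_pos]
  intro i
  obtain ⟨u, rfl⟩ := hV
  have hs : M = u * diagonal d * ((u⁻¹ : (Matrix ι ι ℝ)ˣ) : Matrix ι ι ℝ) := by
    rw [← h, mul_assoc, Units.mul_inv, mul_one]
  have : hM.eigenvalues i ∈ spectrum ℝ (u * diagonal d * ((u⁻¹ : (Matrix ι ι ℝ)ˣ) : Matrix ι ι ℝ)) := by
    convert! hM.eigenvalues_mem_spectrum_real i using 2
    exact hs.symm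
  rw [spectrum.units_conjugate, _root_.spectrum_diagonal] at this
  obtain ⟨j, hj⟩ := this
  rw [← hj]
  exact hd j

theorem inv_mul_of_similar_diagonal (hV : IsUnit V) (h : M * V = V * diagonal d)
    (hd : ∀ i, d i ≠ 0) : M⁻¹ * V = V * diagonal fun i ↦ (d i)⁻¹ := by
  have hV' := (Matrix.isUnit_iff_isUnit_det _).1 hV
  have hM : IsUnit M.det := by
    have : (M * V).det = (V * diagonal d).det := by rw [h]
    rw [det_mul, det_mul, mul_comm, det_diagonal] at this
    rw [mul_left_cancel₀ hV'.ne_zero this]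
    exact (Finset.prod_ne_zero_iff.2 fun i _ ↦ hd i).isUnit
  have h2 : V = M⁻¹ * V * diagonal d := by
    rw [Matrix.mul_assoc, ← h, ← Matrix.mul_assoc, Matrix.nonsing_inv_mul _ hM, Matrix.one_mul]
  conv_rhs => rw [h2]
  rw [Matrix.mul_assoc, diagonal_mul_diagonal]
  simp [hd]

theorem det_of_similar_diagonal (hV : IsUnit V) (h : M * V = V * diagonal d) :
    M.det = ∏ i, d i := by
  have hV' := (Matrix.isUnit_iff_isUnit_det _).1 hV
  have : (M * V).det = (V * diagonal d).det := by rw [h]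
  rw [det_mul, det_mul, mul_comm, det_diagonal] at this
  exact mul_left_cancel₀ hV'.ne_zero this

theorem trace_of_similar_diagonal (hV : IsUnit V) (h : M * V = V * diagonal d) :
    M.trace = ∑ i, d i := by
  have hV' := (Matrix.isUnit_iff_isUnit_det _).1 hV
  have h2 : M = V * diagonal d * V⁻¹ := by
    rw [← h, Matrix.mul_assoc, Matrix.mul_nonsing_inv _ hV', Matrix.mul_one]
  rw [h2, Matrix.trace_mul_comm, ← Matrix.mul_assoc, Matrix.nonsing_inv_mul _ hV', Matrix.one_mul,
    Matrix.trace_diagonal]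

end Similarity

variable {ζ : ℝ}

theorem gridMatrix_posDef (h0 : 0 ≤ ζ) (h1 : ζ < 1 / 4) (n : ℕ) : (gridMatrix ζ n).PosDef :=
  (gridMatrix_isHermitian ζ n).posDef_of_similar_diagonal (isUnit_gridEigenvectors n)
    (gridMatrix_mul_eigenvectors ζ n) (gridEigenvalue_pos h0 h1 n)

theorem gridMatrix_inv_mul_eigenvectors (h0 : 0 ≤ ζ) (h1 : ζ < 1 / 4) (n : ℕ) :
    (gridMatrix ζ n)⁻¹ * (sineMatrix n ⊗ₖ sineMatrix n) =
      (sineMatrix n ⊗ₖ sineMatrix n) * diagonal fun p ↦ (gridEigenvalue ζ n p)⁻¹ :=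
  inv_mul_of_similar_diagonal (isUnit_gridEigenvectors n) (gridMatrix_mul_eigenvectors ζ n)
    fun p ↦ (gridEigenvalue_pos h0 h1 n p).ne'

theorem one_add_smul_gridMatrix_inv_mul_eigenvectors (h0 : 0 ≤ ζ) (h1 : ζ < 1 / 4) (t : ℝ) (n : ℕ) :
    (1 + t • (gridMatrix ζ n)⁻¹) * (sineMatrix n ⊗ₖ sineMatrix n) =
      (sineMatrix n ⊗ₖ sineMatrix n) * diagonal fun p ↦ 1 + t / gridEigenvalue ζ n p := by
  have hd : (diagonal fun p ↦ 1 + t / gridEigenvalue ζ n p) =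
      1 + t • diagonal fun p ↦ (gridEigenvalue ζ n p)⁻¹ := by
    rw [← Matrix.diagonal_one, ← Matrix.diagonal_smul, Matrix.diagonal_add]
    rfl
  rw [hd, Matrix.add_mul, Matrix.mul_add, Matrix.smul_mul, Matrix.mul_smul,
    gridMatrix_inv_mul_eigenvectors h0 h1, Matrix.one_mul, Matrix.mul_one]

theorem trace_gridMatrix_inv (h0 : 0 ≤ ζ) (h1 : ζ < 1 / 4) (n : ℕ) :
    (gridMatrix ζ n)⁻¹.trace = ∑ p, (gridEigenvalue ζ n p)⁻¹ :=
  trace_of_similar_diagonal (isUnit_gridEigenvectors n) (gridMatrix_inv_mul_eigenvectors h0 h1 n)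

theorem log_det_one_add_smul_gridMatrix_inv (h0 : 0 ≤ ζ) (h1 : ζ < 1 / 4) {t : ℝ} (ht : 0 ≤ t)
    (n : ℕ) : Real.log (1 + t • (gridMatrix ζ n)⁻¹).det =
      ∑ p, Real.log (1 + t / gridEigenvalue ζ n p) := by
  rw [det_of_similar_diagonal (isUnit_gridEigenvectors n)
    (one_add_smul_gridMatrix_inv_mul_eigenvectors h0 h1 t n), Real.log_prod]
  intro p _
  have := gridEigenvalue_pos h0 h1 n p
  positivity

theorem trace_inv_one_add_smul_gridMatrix_inv (h0 : 0 ≤ ζ) (h1 : ζ < 1 / 4) {t : ℝ} (ht : 0 ≤ t)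
    (n : ℕ) : (1 + t • (gridMatrix ζ n)⁻¹)⁻¹.trace =
      ∑ p, (1 + t / gridEigenvalue ζ n p)⁻¹ := by
  refine trace_of_similar_diagonal (isUnit_gridEigenvectors n)
    (inv_mul_of_similar_diagonal (isUnit_gridEigenvectors n)
    (one_add_smul_gridMatrix_inv_mul_eigenvectors h0 h1 t n) fun p ↦ ?_)
  have := gridEigenvalue_pos h0 h1 n p
  positivity

end GridMatrix

/-! ### Riemann sums over the grid angles -/

section RiemannSums

open intervalIntegral

theorem intervalIntegrable_comp_floor (G : ℕ → ℝ) (k : ℕ) :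
    IntervalIntegrable (fun x : ℝ ↦ G ⌊x⌋₊) volume (k : ℝ) ((k + 1 : ℕ) : ℝ) := by
  rw [intervalIntegrable_iff_integrableOn_Ico_of_le (by simp)]
  refine IntegrableOn.congr_fun (f := fun _ ↦ G k) (by simp) (fun x hx ↦ ?_) measurableSet_Ico
  have : ⌊x⌋₊ = k := (Nat.floor_eq_iff (k.cast_nonneg.trans hx.1)).2 ⟨hx.1, by simpa using hx.2⟩
  simp [this]

theorem integral_comp_floor (G : ℕ → ℝ) (n : ℕ) :
    ∫ x in (0 : ℝ)..n, G ⌊x⌋₊ = ∑ j : Fin n, G j := by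
  have h := sum_integral_adjacent_intervals (f := fun x : ℝ ↦ G ⌊x⌋₊) (μ := volume)
    (a := fun k : ℕ ↦ (k : ℝ)) (n := n) (fun k _ ↦ intervalIntegrable_comp_floor G k)
  rw [Nat.cast_zero] at h
  rw [← h, ← Finset.sum_range (fun j ↦ G j)]
  refine Finset.sum_congr rfl fun k _ ↦ ?_
  rw [integral_of_le (by simp), ← integral_Ico_eq_integral_Ioc,
    setIntegral_congr_fun (g := fun _ ↦ G k) measurableSet_Ico]
  · simp
  · intro x hx
    have : ⌊x⌋₊ = k := (Nat.floor_eq_iff (k.cast_nonneg.trans hx.1)).2 ⟨hx.1, by simpa using hx.2⟩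
    simp [this]

/-- Writing an average as the integral of a step function over `[0, 1]` lets dominated convergence
handle the Riemann sums. -/
theorem integral_comp_floor_mul (G : ℕ → ℝ) {n : ℕ} (hn : n ≠ 0) :
    ∫ x in (0 : ℝ)..1, G ⌊n * x⌋₊ = 1 / n * ∑ j : Fin n, G j := by
  have hn' : (n : ℝ) ≠ 0 := by exact_mod_cast hn
  rw [integral_comp_mul_left (fun x ↦ G ⌊x⌋₊) hn', mul_zero, mul_one, integral_comp_floor]
  simp

theorem tendsto_gridAngle_floor {x : ℝ} (hx : 0 ≤ x) :
    Tendsto (fun n : ℕ ↦ gridAngle n ⌊n * x⌋₊) atTop (𝓝 (Real.pi * x)) := by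
  have h1 : Tendsto (fun n : ℕ ↦ (⌊x * n⌋₊ : ℝ) / n) atTop (𝓝 x) :=
    (tendsto_nat_floor_mul_div_atTop hx).comp tendsto_natCast_atTop_atTop
  have h2 : Tendsto (fun n : ℕ ↦ (n : ℝ) / ((n : ℝ) + 1)) atTop (𝓝 1) :=
    tendsto_natCast_div_add_atTop 1
  have h3 : Tendsto (fun n : ℕ ↦ 1 / ((n : ℝ) + 1)) atTop (𝓝 0) :=
    tendsto_one_div_add_atTop_nhds_zero_nat
  have h := (((h1.mul h2).add h3).mul_const Real.pi)
  rw [mul_one, add_zero, mul_comm] at h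
  refine h.congr' ?_
  filter_upwards [eventually_ne_atTop 0] with n hn
  have hn' : (n : ℝ) ≠ 0 := by exact_mod_cast hn
  unfold gridAngle
  rw [mul_comm x]
  field_simp

variable {F : ℝ → ℝ → ℝ}

theorem tendsto_riemannSum_gridAngle (hF : Continuous fun x : ℝ × ℝ ↦ F x.1 x.2) {C : ℝ}
    (hC : ∀ x y, |F x y| ≤ C) :
    Tendsto (fun n : ℕ ↦ 1 / (n : ℝ) ^ 2 *
      ∑ p : Fin n × Fin n, F (gridAngle n p.1) (gridAngle n p.2)) atTop
      (𝓝 (∫ x in (0 : ℝ)..1, ∫ y in (0 : ℝ)..1, F (Real.pi * x) (Real.pi * y))) := by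
  have hmeas : ∀ (n : ℕ) (G : ℕ → ℝ), Measurable fun x : ℝ ↦ G ⌊n * x⌋₊ := fun n G ↦
    (measurable_from_nat (f := G)).comp (Nat.measurable_floor.comp (measurable_const_mul _))
  have key : ∀ x : ℝ, 0 ≤ x → Tendsto (fun n : ℕ ↦ ∫ y in (0 : ℝ)..1,
      F (gridAngle n ⌊n * x⌋₊) (gridAngle n ⌊n * y⌋₊)) atTop
      (𝓝 (∫ y in (0 : ℝ)..1, F (Real.pi * x) (Real.pi * y))) := by
    intro x hx
    refine intervalIntegral.tendsto_integral_filter_of_dominated_convergence (fun _ ↦ C)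
      (.of_forall fun n ↦ ?_) (.of_forall fun n ↦ .of_forall fun y _ ↦ hC _ _)
      intervalIntegrable_const (.of_forall fun y hy ↦ ?_)
    · exact (hmeas n fun k ↦ F (gridAngle n ⌊n * x⌋₊) (gridAngle n k)).aestronglyMeasurable
    · rw [Set.uIoc_of_le zero_le_one] at hy
      exact (hF.tendsto (Real.pi * x, Real.pi * y)).comp
        ((tendsto_gridAngle_floor hx).prodMk_nhds (tendsto_gridAngle_floor hy.1.le))
  have h2 : Tendsto (fun n : ℕ ↦ ∫ x in (0 : ℝ)..1, ∫ y in (0 : ℝ)..1,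
      F (gridAngle n ⌊n * x⌋₊) (gridAngle n ⌊n * y⌋₊)) atTop
      (𝓝 (∫ x in (0 : ℝ)..1, ∫ y in (0 : ℝ)..1, F (Real.pi * x) (Real.pi * y))) := by
    refine intervalIntegral.tendsto_integral_filter_of_dominated_convergence (fun _ ↦ C)
      (.of_forall fun n ↦ ?_) (.of_forall fun n ↦ .of_forall fun x _ ↦ ?_)
      intervalIntegrable_const (.of_forall fun x hx ↦ ?_)
    · exact (hmeas n fun k ↦ ∫ y in (0 : ℝ)..1,
        F (gridAngle n k) (gridAngle n ⌊n * y⌋₊)).aestronglyMeasurable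
    · simpa using norm_integral_le_of_norm_le_const (a := 0) (b := 1) (C := C)
        (f := fun y ↦ F (gridAngle n ⌊n * x⌋₊) (gridAngle n ⌊n * y⌋₊)) fun y _ ↦ hC _ _
    · rw [Set.uIoc_of_le zero_le_one] at hx
      exact key x hx.1.le
  refine h2.congr' ?_
  filter_upwards [eventually_ne_atTop 0] with n hn
  rw [integral_comp_floor_mul (fun k ↦ ∫ y in (0 : ℝ)..1,
    F (gridAngle n k) (gridAngle n ⌊n * y⌋₊)) hn, Fintype.sum_prod_type]
  simp_rw [fun k : Fin n ↦ integral_comp_floor_mul (fun l ↦ F (gridAngle n k) (gridAngle n l)) hn]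
  rw [← Finset.mul_sum]
  ring

theorem integral_neg_pi_pi_of_even {f : ℝ → ℝ} (hf : Continuous f) (heven : ∀ x, f (-x) = f x) :
    ∫ x in (-Real.pi)..Real.pi, f x = 2 * Real.pi * ∫ x in (0 : ℝ)..1, f (Real.pi * x) := by
  rw [← integral_add_adjacent_intervals (hf.intervalIntegrable (-Real.pi) 0)
    (hf.intervalIntegrable 0 Real.pi)]
  have h : ∫ x in (-Real.pi)..0, f x = ∫ x in (0 : ℝ)..Real.pi, f x := by
    have := integral_comp_neg (a := 0) (b := Real.pi) f
    simp only [heven, neg_zero] at this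
    exact this.symm
  rw [h, integral_comp_mul_left f Real.pi_ne_zero, mul_zero, mul_one, smul_eq_mul]
  have := Real.pi_ne_zero
  field_simp
  ring

/-- The angles fill only `(0, π)²`; evenness in each variable extends the average to the full
square. -/
theorem tendsto_riemannSum_gridAngle_of_even (hF : Continuous fun x : ℝ × ℝ ↦ F x.1 x.2) {C : ℝ}
    (hC : ∀ x y, |F x y| ≤ C) (h1 : ∀ x y, F (-x) y = F x y) (h2 : ∀ x y, F x (-y) = F x y) :
    Tendsto (fun n : ℕ ↦ 1 / (n : ℝ) ^ 2 *
      ∑ p : Fin n × Fin n, F (gridAngle n p.1) (gridAngle n p.2)) atTop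
      (𝓝 (1 / (4 * Real.pi ^ 2) *
        ∫ x in (-Real.pi)..Real.pi, ∫ y in (-Real.pi)..Real.pi, F x y)) := by
  convert tendsto_riemannSum_gridAngle hF hC using 2
  have hF1 : ∀ x, Continuous (F x) := fun x ↦ hF.comp (Continuous.prodMk_right x)
  have hF2 : Continuous fun x ↦ ∫ y in (-Real.pi)..Real.pi, F x y :=
    continuous_parametric_intervalIntegral_of_continuous' hF _ _
  rw [integral_neg_pi_pi_of_even hF2 (fun x ↦ by simp only [h1])]
  simp_rw [fun x ↦ integral_neg_pi_pi_of_even (hF1 x) (h2 x)]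
  rw [intervalIntegral.integral_const_mul]
  have := Real.pi_ne_zero
  field_simp
  ring

end RiemannSums

/-! ### The mean of the inverse symbol as a complete elliptic integral -/

section EllipticIntegral

open intervalIntegral

/-- With `a = 2ρ / (1 + ρ²)` and `|ρ| < 1` the integrand is a multiple of the Poisson kernel. The
arctangent in the antiderivative is `-arg (1 - ρ e^{iu})`, smooth on the whole period, unlike the
one from `tan (u / 2)`; it vanishes at both ends, so only the linear term contributes. -/
theorem integral_one_div_one_sub_mul_cos {a : ℝ} (ha : |a| < 1) :
    ∫ u in (-Real.pi)..Real.pi, 1 / (1 - a * Real.cos u) = 2 * Real.pi / √(1 - a ^ 2) := by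
  have ha2 : 0 < 1 - a ^ 2 := by rw [sub_pos, sq_lt_one_iff_abs_lt_one]; exact ha
  set s := √(1 - a ^ 2) with hs
  have hs0 : 0 < s := Real.sqrt_pos.2 ha2
  have hs2 : s ^ 2 = 1 - a ^ 2 := Real.sq_sqrt ha2.le
  -- The root of `a ρ² - 2ρ + a = 0` inside the unit interval, in a form that also covers `a = 0`.
  set ρ := a / (1 + s) with hρ
  have hρa : a = ρ * (1 + s) := by rw [hρ]; field_simp
  have hρs : s * (1 + ρ ^ 2) = 1 - ρ ^ 2 := by
    have h : (1 + s) * (s * (1 + ρ ^ 2) - (1 - ρ ^ 2)) = 0 := by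
      rw [hρa] at hs2
      linear_combination hs2
    rcases mul_eq_zero.1 h with h | h <;> linarith
  have hρ1 : |ρ| < 1 := by
    rw [hρ, abs_div, abs_of_pos (by linarith : 0 < 1 + s), div_lt_one (by linarith)]
    linarith
  clear_value ρ s
  have hden : ∀ r u : ℝ, |r| < 1 → 0 < 1 - r * Real.cos u := fun r u hr ↦ by
    have h1 : |r * Real.cos u| ≤ |r| := by
      rw [abs_mul]; exact mul_le_of_le_one_right (abs_nonneg _) (Real.abs_cos_le_one u)
    linarith [le_abs_self (r * Real.cos u)]
  have hderiv : ∀ u ∈ Set.uIcc (-Real.pi) Real.pi, HasDerivAt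
      (fun u ↦ 1 / s * (u + 2 * Real.arctan (ρ * Real.sin u / (1 - ρ * Real.cos u))))
      (1 / (1 - a * Real.cos u)) u := by
    intro u _
    have hd := hden ρ u hρ1
    have h1 : HasDerivAt (fun u ↦ ρ * Real.sin u / (1 - ρ * Real.cos u))
        ((ρ * Real.cos u * (1 - ρ * Real.cos u) - ρ * Real.sin u * (ρ * Real.sin u)) /
          (1 - ρ * Real.cos u) ^ 2) u := by
      refine ((Real.hasDerivAt_sin u).const_mul ρ).div ?_ hd.ne'
      simpa using ((Real.hasDerivAt_cos u).const_mul ρ).const_sub 1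
    refine (((hasDerivAt_id u).add (h1.arctan.const_mul 2)).const_mul (1 / s)).congr_deriv ?_
    have hsc := Real.sin_sq_add_cos_sq u
    have hA := hden a u ha
    set x := Real.cos u
    set y := Real.sin u
    have hq : (1 - ρ * x) ^ 2 + (ρ * y) ^ 2 = 1 - 2 * ρ * x + ρ ^ 2 := by
      linear_combination ρ ^ 2 * hsc
    have hq0 : 0 < 1 - 2 * ρ * x + ρ ^ 2 := by
      rw [← hq]; positivity
    have e1 : 1 / (1 + (ρ * y / (1 - ρ * x)) ^ 2) = (1 - ρ * x) ^ 2 / (1 - 2 * ρ * x + ρ ^ 2) := by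
      rw [← hq]; field_simp
    have e2 : ρ * x * (1 - ρ * x) - ρ * y * (ρ * y) = ρ * x - ρ ^ 2 := by
      linear_combination (-ρ ^ 2) * hsc
    rw [e1, e2]
    have e3 : (1 - ρ * x) ^ 2 / (1 - 2 * ρ * x + ρ ^ 2) *
        ((ρ * x - ρ ^ 2) / (1 - ρ * x) ^ 2) = (ρ * x - ρ ^ 2) / (1 - 2 * ρ * x + ρ ^ 2) := by
      field_simp
    have e4 : 1 + 2 * ((ρ * x - ρ ^ 2) / (1 - 2 * ρ * x + ρ ^ 2)) =
        (1 - ρ ^ 2) / (1 - 2 * ρ * x + ρ ^ 2) := by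
      field_simp; ring
    rw [e3, e4, one_div_mul_eq_div, div_div, div_eq_div_iff (by positivity) hA.ne']
    have h3 : (1 + ρ ^ 2) * a = 2 * ρ := by
      rw [hρa]; linear_combination ρ * hρs
    have h4 : 0 < 1 + ρ ^ 2 := by positivity
    refine mul_left_cancel₀ h4.ne' ?_
    linear_combination (-(1 - ρ ^ 2) * x) * h3 - (1 - 2 * ρ * x + ρ ^ 2) * hρs
  rw [integral_eq_sub_of_hasDerivAt hderiv]
  · simp; ring
  · refine Continuous.intervalIntegrable ?_ _ _
    exact continuous_const.div (by fun_prop) fun u ↦ (hden a u ha).ne'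

/-- Put `y = x + t`, exchange the integrals, then put `u = x + t / 2`; the shifts cost nothing by
periodicity. The product form leaves an inner integral of the type `1 / (1 - a cos u)`. -/
theorem integral_comp_cos_add_cos {Φ : ℝ → ℝ} (hΦ : Continuous fun x : ℝ × ℝ ↦ Φ (Real.cos x.1 + Real.cos x.2)) :
    ∫ x in (-Real.pi)..Real.pi, ∫ y in (-Real.pi)..Real.pi, Φ (Real.cos x + Real.cos y) =
      ∫ t in (-Real.pi)..Real.pi, ∫ u in (-Real.pi)..Real.pi,
        Φ (2 * Real.cos (t / 2) * Real.cos u) := by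
  have hshift : ∀ (g : ℝ → ℝ) (a : ℝ), Function.Periodic g (2 * Real.pi) →
      ∫ t in (-Real.pi)..Real.pi, g (t + a) = ∫ t in (-Real.pi)..Real.pi, g t := by
    intro g a hg
    rw [integral_comp_add_right]
    have := hg.intervalIntegral_add_eq (-Real.pi + a) (-Real.pi)
    rw [show -Real.pi + a + 2 * Real.pi = Real.pi + a by ring,
      show -Real.pi + 2 * Real.pi = Real.pi by ring] at this
    exact this
  have h1 : ∀ x, ∫ y in (-Real.pi)..Real.pi, Φ (Real.cos x + Real.cos y) =
      ∫ t in (-Real.pi)..Real.pi, Φ (Real.cos x + Real.cos (t + x)) := fun x ↦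
    (hshift (fun y ↦ Φ (Real.cos x + Real.cos y)) x fun y ↦ by simp).symm
  simp_rw [h1]
  have hle : -Real.pi ≤ Real.pi := by linarith [Real.pi_pos]
  have hswap : ∫ x in (-Real.pi)..Real.pi, ∫ t in (-Real.pi)..Real.pi,
        Φ (Real.cos x + Real.cos (t + x)) =
      ∫ t in (-Real.pi)..Real.pi, ∫ x in (-Real.pi)..Real.pi,
        Φ (Real.cos x + Real.cos (t + x)) := by
    simp only [intervalIntegral.integral_of_le hle]
    refine integral_integral_swap (f := fun x t ↦ Φ (Real.cos x + Real.cos (t + x))) ?_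
    have hc : Continuous fun x : ℝ × ℝ ↦ Φ (Real.cos x.1 + Real.cos (x.2 + x.1)) :=
      hΦ.comp (continuous_fst.prodMk (continuous_snd.add continuous_fst))
    rw [Measure.prod_restrict]
    exact (hc.continuousOn.integrableOn_compact
      (isCompact_Icc.prod isCompact_Icc)).mono_set
      (Set.prod_mono Set.Ioc_subset_Icc_self Set.Ioc_subset_Icc_self)
  rw [hswap]
  · refine integral_congr fun t _ ↦ ?_
    rw [← hshift (fun u ↦ Φ (2 * Real.cos (t / 2) * Real.cos u)) (t / 2) fun y ↦ by simp]
    refine integral_congr fun x _ ↦ ?_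
    congr 1
    rw [Real.cos_add_cos]
    rw [show (x - (t + x)) / 2 = -(t / 2) by ring, show (x + (t + x)) / 2 = x + t / 2 by ring,
      Real.cos_neg]
    ring

theorem continuous_one_div_sqrt_one_sub_mul_sin {k : ℝ} (h : |k| < 1) :
    Continuous fun θ : ℝ ↦ 1 / √(1 - k ^ 2 * Real.sin θ ^ 2) := by
  refine continuous_const.div (by fun_prop) fun θ ↦ (Real.sqrt_pos.2 ?_).ne'
  have h1 : k ^ 2 < 1 := (sq_lt_one_iff_abs_lt_one k).2 h
  nlinarith [Real.sin_sq_le_one θ, sq_nonneg k]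

theorem ellipticK_eq_ofReal {k : ℝ} (h : |k| < 1) : ellipticK k =
    ENNReal.ofReal (∫ θ in (0 : ℝ)..(Real.pi / 2), 1 / √(1 - k ^ 2 * Real.sin θ ^ 2)) := by
  have hpi : (0 : ℝ) ≤ Real.pi / 2 := by positivity
  rw [ellipticK, integral_of_le hpi, integral_Ioc_eq_integral_Ioo, ofReal_integral_eq_lintegral_ofReal]
  · exact ((continuous_one_div_sqrt_one_sub_mul_sin h).integrableOn_Icc).mono_set
      Set.Ioo_subset_Icc_self
  · exact .of_forall fun θ ↦ by positivity

theorem ellipticK_one : ellipticK 1 = ∞ := by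
  by_contra hne
  have hmeas : Measurable fun θ : ℝ ↦ 1 / √(1 - 1 ^ 2 * Real.sin θ ^ 2) := by fun_prop
  have hint : IntegrableOn (fun θ : ℝ ↦ 1 / √(1 - 1 ^ 2 * Real.sin θ ^ 2))
      (Set.Ioo 0 (Real.pi / 2)) := by
    refine ⟨hmeas.aestronglyMeasurable, ?_⟩
    rw [hasFiniteIntegral_iff_ofReal (.of_forall fun θ ↦ by positivity)]
    exact lt_top_iff_ne_top.2 hne
  have hpi : (0 : ℝ) < Real.pi / 2 := by positivity
  -- At modulus 1 the integrand is `1 / cos θ ≥ 1 / (π/2 - θ)`, which is not integrable up to `π/2`.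
  have hcontra : IntervalIntegrable (fun x ↦ (x - Real.pi / 2)⁻¹) volume 0 (Real.pi / 2) := by
    rw [intervalIntegrable_iff_integrableOn_Ioo_of_le hpi.le]
    refine hint.mono' (by fun_prop) ?_
    filter_upwards [ae_restrict_mem measurableSet_Ioo] with x hx
    have hc : 0 < Real.cos x := Real.cos_pos_of_mem_Ioo ⟨by linarith [hx.1], hx.2⟩
    have h1 : 1 - 1 ^ 2 * Real.sin x ^ 2 = Real.cos x ^ 2 := by
      rw [Real.cos_sq']; ring
    rw [h1, Real.sqrt_sq hc.le, Real.norm_eq_abs, abs_inv, abs_sub_comm,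
      abs_of_pos (by linarith [hx.2]), ← one_div]
    refine one_div_le_one_div_of_le hc ?_
    rw [← Real.sin_pi_div_two_sub]
    exact Real.sin_le (by linarith [hx.2])
  rw [intervalIntegrable_sub_inv_iff] at hcontra
  rcases hcontra with h | h
  · exact hpi.ne h
  · exact h Set.right_mem_uIcc

variable {ζ : ℝ}

theorem one_sub_cos_sub_cos_pos (h0 : 0 ≤ ζ) (h1 : ζ < 1 / 4) (x y : ℝ) :
    0 < 1 - 2 * ζ * Real.cos x - 2 * ζ * Real.cos y := by
  nlinarith [Real.cos_le_one x, Real.cos_le_one y]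

/-- The inner integral has `a = 4ζ cos (t / 2)`. The halved angle runs over `[-π/2, π/2]`; evenness
and the reflection `θ ↦ π/2 - θ` turn cosine into sine. -/
theorem average_one_div_eq_ellipticK (h0 : 0 ≤ ζ) (h1 : ζ < 1 / 4) :
    1 / (4 * Real.pi ^ 2) * ∫ x in (-Real.pi)..Real.pi, ∫ y in (-Real.pi)..Real.pi,
      (1 - 2 * ζ * Real.cos x - 2 * ζ * Real.cos y)⁻¹ =
      2 / Real.pi * (ellipticK (4 * ζ)).toReal := by
  have hk : |4 * ζ| < 1 := by rw [abs_of_nonneg (by linarith)]; linarith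
  have hcont : Continuous fun x : ℝ × ℝ ↦ (fun s ↦ 1 / (1 - 2 * ζ * s)) (Real.cos x.1 + Real.cos x.2) := by
    refine continuous_const.div (by fun_prop) fun x ↦ ?_
    have := one_sub_cos_sub_cos_pos h0 h1 x.1 x.2
    intro h; linarith
  have e1 := integral_comp_cos_add_cos (Φ := fun s ↦ 1 / (1 - 2 * ζ * s)) hcont
  have e2 : ∀ x y, (1 - 2 * ζ * Real.cos x - 2 * ζ * Real.cos y)⁻¹ =
      1 / (1 - 2 * ζ * (Real.cos x + Real.cos y)) := fun x y ↦ by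
    rw [one_div]; congr 1; ring
  simp_rw [e2]
  rw [e1]
  have e3 : ∀ t, ∫ u in (-Real.pi)..Real.pi, 1 / (1 - 2 * ζ * (2 * Real.cos (t / 2) * Real.cos u)) =
      2 * Real.pi / √(1 - (4 * ζ) ^ 2 * Real.cos (t / 2) ^ 2) := fun t ↦ by
    have := integral_one_div_one_sub_mul_cos (a := 4 * ζ * Real.cos (t / 2)) (by
      rw [abs_mul]
      exact (mul_le_of_le_one_right (abs_nonneg _) (Real.abs_cos_le_one _)).trans_lt hk)
    rw [mul_pow] at this
    rw [← this]
    refine integral_congr fun u _ ↦ ?_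
    congr 2; ring
  simp_rw [e3]
  rw [integral_comp_div (fun θ ↦ 2 * Real.pi / √(1 - (4 * ζ) ^ 2 * Real.cos θ ^ 2)) two_ne_zero]
  have hc : Continuous fun θ ↦ 2 * Real.pi / √(1 - (4 * ζ) ^ 2 * Real.cos θ ^ 2) := by
    have := (continuous_one_div_sqrt_one_sub_mul_sin hk).comp
      (f := fun θ : ℝ ↦ Real.pi / 2 - θ) (by fun_prop)
    refine (this.const_mul (2 * Real.pi)).congr fun θ ↦ ?_
    simp only [Function.comp_apply, Real.sin_pi_div_two_sub]
    ring
  rw [neg_div, ← integral_add_adjacent_intervals (hc.intervalIntegrable (-(Real.pi / 2)) 0)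
    (hc.intervalIntegrable 0 (Real.pi / 2))]
  have e4 : ∫ θ in (-(Real.pi / 2))..0, 2 * Real.pi / √(1 - (4 * ζ) ^ 2 * Real.cos θ ^ 2) =
      ∫ θ in (0 : ℝ)..(Real.pi / 2), 2 * Real.pi / √(1 - (4 * ζ) ^ 2 * Real.cos θ ^ 2) := by
    have := integral_comp_neg (a := 0) (b := Real.pi / 2)
      fun θ ↦ 2 * Real.pi / √(1 - (4 * ζ) ^ 2 * Real.cos θ ^ 2)
    simp only [Real.cos_neg, neg_zero] at this
    exact this.symm
  have e5 : ∫ θ in (0 : ℝ)..(Real.pi / 2), 2 * Real.pi / √(1 - (4 * ζ) ^ 2 * Real.cos θ ^ 2) =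
      2 * Real.pi * ∫ θ in (0 : ℝ)..(Real.pi / 2), 1 / √(1 - (4 * ζ) ^ 2 * Real.sin θ ^ 2) := by
    have := integral_comp_sub_left (a := 0) (b := Real.pi / 2)
      (fun θ ↦ 2 * Real.pi / √(1 - (4 * ζ) ^ 2 * Real.cos θ ^ 2)) (Real.pi / 2)
    simp only [Real.cos_pi_div_two_sub, sub_zero, sub_self] at this
    rw [← this, ← intervalIntegral.integral_const_mul]
    simp [div_eq_mul_inv]
  have hK : (ellipticK (4 * ζ)).toReal =
      ∫ θ in (0 : ℝ)..(Real.pi / 2), 1 / √(1 - (4 * ζ) ^ 2 * Real.sin θ ^ 2) := by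
    rw [ellipticK_eq_ofReal hk, ENNReal.toReal_ofReal]
    exact integral_nonneg (by positivity) fun θ _ ↦ by positivity
  rw [e4, e5, hK]
  have := Real.pi_ne_zero
  simp only [smul_eq_mul]
  field_simp
  ring

end EllipticIntegral

/-! ### The Green function equation for the covariance -/

section Covariance

variable {Ω : Type*} [mΩ : MeasurableSpace Ω] {μ : Measure Ω} {X : LatticeField Ω}

theorem IsStationaryGaussianField.memLp_two (hX : IsStationaryGaussianField X μ) (p : ℤ × ℤ) :
    MemLp (X p) 2 μ :=
  (hX.gaussian.hasGaussianLaw_eval p).memLp_two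

theorem IsStationaryGaussianField.integrable_mul (hX : IsStationaryGaussianField X μ)
    (p q : ℤ × ℤ) : Integrable (fun ω ↦ X p ω * X q ω) μ :=
  (hX.memLp_two p).integrable_mul (hX.memLp_two q)

/-- The second moments of a random field. -/
noncomputable def fieldCov (X : LatticeField Ω) (μ : Measure Ω) (p q : ℤ × ℤ) : ℝ :=
  ∫ ω, X p ω * X q ω ∂μ

/-- The sum of a function over the four nearest neighbours of a node. -/
def neighbourSum (f : ℤ × ℤ → ℝ) (p : ℤ × ℤ) : ℝ :=
  f (p.1 + 1, p.2) + f (p.1 - 1, p.2) + f (p.1, p.2 + 1) + f (p.1, p.2 - 1)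

theorem IsStationaryGaussianField.covariance_eq [IsProbabilityMeasure μ]
    (hX : IsStationaryGaussianField X μ) (p q : ℤ × ℤ) :
    cov[X p, X q; μ] = fieldCov X μ p q := by
  rw [covariance_eq_sub (hX.memLp_two p) (hX.memLp_two q), hX.zero_mean, hX.zero_mean]
  simp [fieldCov]

theorem IsStationaryGaussianField.fieldCov_self [IsProbabilityMeasure μ]
    (hX : IsStationaryGaussianField X μ) (p : ℤ × ℤ) :
    fieldCov X μ p p = ∫ ω, X (0, 0) ω ^ 2 ∂μ := by
  have h := hX.stationary (0, 0) (0, 0) p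
  rw [hX.covariance_eq, hX.covariance_eq, Prod.mk_zero_zero, zero_add] at h
  rw [h, fieldCov, Prod.mk_zero_zero]
  simp only [pow_two]

theorem IsStationaryGaussianField.abs_fieldCov_le [IsProbabilityMeasure μ]
    (hX : IsStationaryGaussianField X μ) (p q : ℤ × ℤ) :
    |fieldCov X μ p q| ≤ ∫ ω, X (0, 0) ω ^ 2 ∂μ := by
  have h : |fieldCov X μ p q| ≤ ∫ ω, (X p ω * X p ω + X q ω * X q ω) / 2 ∂μ := by
    refine (abs_integral_le_integral_abs).trans (integral_mono (hX.integrable_mul p q).abs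
      (((hX.integrable_mul p p).add (hX.integrable_mul q q)).div_const 2) fun ω ↦ ?_)
    simp only [abs_le]
    constructor <;> nlinarith [sq_nonneg (X p ω - X q ω), sq_nonneg (X p ω + X q ω)]
  rw [integral_div, integral_add (hX.integrable_mul p p) (hX.integrable_mul q q)] at h
  have e1 := hX.fieldCov_self p
  have e2 := hX.fieldCov_self q
  unfold fieldCov at *
  linarith

theorem othersSigma_le (hX : ∀ i, Measurable (X i)) (i : ℤ × ℤ) : othersSigma X i ≤ mΩ :=
  iSup_le fun j ↦ (hX j.1).comap_le

omit mΩ in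
theorem stronglyMeasurable_othersSigma {i j : ℤ × ℤ} (h : j ≠ i) :
    StronglyMeasurable[othersSigma X i] (X j) := by
  have h1 : Measurable[MeasurableSpace.comap (X j) inferInstance] (X j) := comap_measurable _
  exact (h1.mono (le_iSup (fun k : {k : ℤ × ℤ // k ≠ i} ↦
    MeasurableSpace.comap (X k.1) inferInstance) ⟨j, h⟩) le_rfl).stronglyMeasurable

variable {κ lam : ℝ}

theorem integrable_neighbourSum {G : ℤ × ℤ → Ω → ℝ} (h : ∀ s, Integrable (G s) μ) (p : ℤ × ℤ) :
    Integrable (fun ω ↦ neighbourSum (fun s ↦ G s ω) p) μ :=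
  (((h _).add (h _)).add (h _)).add (h _)

theorem integral_neighbourSum {G : ℤ × ℤ → Ω → ℝ} (h : ∀ s, Integrable (G s) μ) (p : ℤ × ℤ) :
    ∫ ω, neighbourSum (fun s ↦ G s ω) p ∂μ = neighbourSum (fun s ↦ ∫ ω, G s ω ∂μ) p := by
  simp only [neighbourSum]
  rw [integral_add (((h _).fun_add (h _)).fun_add (h _)) (h _),
    integral_add ((h _).fun_add (h _)) (h _), integral_add (h _) (h _)]

theorem neighbourSum_mul (f : ℤ × ℤ → ℝ) (p : ℤ × ℤ) (c : ℝ) :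
    neighbourSum f p * c = neighbourSum (fun s ↦ f s * c) p := by
  simp only [neighbourSum]; ring

theorem IsStationaryGaussianField.integrable_neighbourSum_mul
    (hX : IsStationaryGaussianField X μ) (p q : ℤ × ℤ) :
    Integrable (fun ω ↦ neighbourSum (fun s ↦ X s ω) p * X q ω) μ := by
  simp only [neighbourSum_mul]
  exact integrable_neighbourSum (fun s ↦ hX.integrable_mul s q) p

theorem IsStationaryGaussianField.integral_neighbourSum_mul
    (hX : IsStationaryGaussianField X μ) (p q : ℤ × ℤ) :
    ∫ ω, neighbourSum (fun s ↦ X s ω) p * X q ω ∂μ = neighbourSum (fun s ↦ fieldCov X μ s q) p := by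
  simp only [neighbourSum_mul]
  exact integral_neighbourSum (fun s ↦ hX.integrable_mul s q) p

/-- For `q ≠ p` the variable `X q` is measurable for the conditioning sigma-algebra, so it can be
pulled out before taking expectations. -/
theorem IsSFCAR.fieldCov_of_ne [IsProbabilityMeasure μ] (hX : IsSFCAR X κ lam μ) {p q : ℤ × ℤ}
    (h : q ≠ p) :
    fieldCov X μ p q = lam / κ * neighbourSum (fun s ↦ fieldCov X μ s q) p := by
  have hle := othersSigma_le hX.field.measurable p
  have h1 : μ[X p * X q | othersSigma X p] =ᵐ[μ] μ[X p | othersSigma X p] * X q :=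
    condExp_mul_of_stronglyMeasurable_right (stronglyMeasurable_othersSigma h)
      (hX.field.integrable_mul p q) ((hX.field.memLp_two p).integrable one_le_two)
  have h2 := integral_condExp (μ := μ) (f := X p * X q) hle
  rw [integral_congr_ae h1] at h2
  have h3 : ∫ ω, (μ[X p | othersSigma X p] * X q) ω ∂μ =
      ∫ ω, lam / κ * (neighbourSum (fun s ↦ X s ω) p * X q ω) ∂μ := by
    refine integral_congr_ae ?_
    filter_upwards [hX.cond_mean p.1 p.2] with ω hω
    rw [Pi.mul_apply]
    simp only [Prod.mk.eta] at hω
    rw [hω, neighbourSum]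
    ring
  rw [h3, integral_const_mul, hX.field.integral_neighbourSum_mul] at h2
  exact h2.symm

/-- The prediction error `X p - ζ N`, with `ζ = lam / κ` and `N` the neighbour sum, has second
moment `κ⁻¹` and is orthogonal to `N`. Expanding the square leaves `E[X p ²] = ζ E[N X p] + κ⁻¹`. -/
theorem IsSFCAR.fieldCov_self_eq [IsProbabilityMeasure μ] (hX : IsSFCAR X κ lam μ) (p : ℤ × ℤ) :
    fieldCov X μ p p = lam / κ * neighbourSum (fun s ↦ fieldCov X μ s p) p + κ⁻¹ := by
  have hle := othersSigma_le hX.field.measurable p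
  set N : Ω → ℝ := fun ω ↦ neighbourSum (fun s ↦ X s ω) p with hN
  have h1 : ∫ ω, (X p ω - lam / κ * N ω) ^ 2 ∂μ = κ⁻¹ := by
    have h2 := integral_congr_ae (hX.cond_precision p.1 p.2)
    rw [condVar, integral_condExp hle] at h2
    simp only [integral_const, probReal_univ, one_smul, Prod.mk.eta] at h2
    rw [← h2]
    refine integral_congr_ae ?_
    filter_upwards [hX.cond_mean p.1 p.2] with ω hω
    simp only [Prod.mk.eta] at hω
    simp only [Pi.pow_apply, Pi.sub_apply, hω]
    rfl
  have hNL : MemLp N 2 μ := by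
    simp only [hN, neighbourSum]
    exact (((hX.field.memLp_two _).add (hX.field.memLp_two _)).add (hX.field.memLp_two _)).add
      (hX.field.memLp_two _)
  have hNq : ∀ q, Integrable (fun ω ↦ N ω * X q ω) μ := fun q ↦
    hX.field.integrable_neighbourSum_mul p q
  -- Orthogonality of the error to `N`, summed from the off-diagonal equation at the four neighbours
  -- of `p`.
  have hNN : ∫ ω, N ω * X p ω ∂μ = lam / κ * ∫ ω, N ω * N ω ∂μ := by
    have e : ∀ q, q ≠ p → ∫ ω, X p ω * X q ω ∂μ = lam / κ * ∫ ω, N ω * X q ω ∂μ := fun q hq ↦ by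
      rw [hX.field.integral_neighbourSum_mul]; exact hX.fieldCov_of_ne hq
    have hNN' : ∫ ω, N ω * N ω ∂μ = neighbourSum (fun s ↦ ∫ ω, N ω * X s ω ∂μ) p := by
      have hexp : ∀ ω, N ω * N ω = neighbourSum (fun s ↦ N ω * X s ω) p := fun ω ↦ by
        have := neighbourSum_mul (fun s ↦ X s ω) p (N ω)
        simpa only [mul_comm _ (N ω)] using this
      simp_rw [hexp]
      exact integral_neighbourSum hNq p
    rw [hNN', hX.field.integral_neighbourSum_mul]
    have e' : ∀ q, q ≠ p → fieldCov X μ q p = lam / κ * ∫ ω, N ω * X q ω ∂μ := fun q hq ↦ by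
      rw [← e q hq, fieldCov]; simp only [mul_comm]
    simp only [neighbourSum]
    rw [e' (p.1 + 1, p.2) (by simp [Prod.ext_iff]), e' (p.1 - 1, p.2) (by simp [Prod.ext_iff]),
      e' (p.1, p.2 + 1) (by simp [Prod.ext_iff]), e' (p.1, p.2 - 1) (by simp [Prod.ext_iff])]
    ring
  have hexp : ∀ ω, (X p ω - lam / κ * N ω) ^ 2 =
      X p ω * X p ω - 2 * (lam / κ) * (N ω * X p ω) + (lam / κ) ^ 2 * (N ω * N ω) := fun ω ↦ by ring
  simp_rw [hexp] at h1
  have hNNi : Integrable (fun ω ↦ N ω * N ω) μ := hNL.integrable_mul hNL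
  have hi : Integrable (fun ω ↦ X p ω * X p ω - 2 * (lam / κ) * (N ω * X p ω)) μ :=
    (hX.field.integrable_mul p p).sub ((hNq p).const_mul _)
  rw [integral_add hi (hNNi.const_mul _),
    integral_sub (hX.field.integrable_mul p p) ((hNq p).const_mul _), integral_const_mul,
    integral_const_mul] at h1
  have h4 := hX.field.integral_neighbourSum_mul p p
  rw [← h4, fieldCov]
  change _ = lam / κ * ∫ ω, N ω * X p ω ∂μ + κ⁻¹
  linear_combination h1 + (lam / κ) * hNN

theorem IsSFCAR.fieldCov_eq [IsProbabilityMeasure μ] (hX : IsSFCAR X κ lam μ) (p q : ℤ × ℤ) :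
    fieldCov X μ p q =
      lam / κ * neighbourSum (fun s ↦ fieldCov X μ s q) p + if p = q then κ⁻¹ else 0 := by
  split_ifs with h
  · subst h; exact hX.fieldCov_self_eq p
  · rw [add_zero]; exact hX.fieldCov_of_ne (Ne.symm h)

end Covariance

/-! ### The box covariance against the Green function of the box -/

section BoxCovariance

open Matrix
open scoped Kronecker

/-- The lattice node of an index of the `n × n` box. -/
def boxNode {n : ℕ} (p : Fin n × Fin n) : ℤ × ℤ := ((p.1.val : ℤ), (p.2.val : ℤ))

theorem boxNode_injective {n : ℕ} : Function.Injective (boxNode (n := n)) := by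
  intro p q h
  simp only [boxNode, Prod.mk.injEq, Nat.cast_inj] at h
  exact Prod.ext (Fin.ext h.1) (Fin.ext h.2)

/-- The restriction of a kernel on the lattice to the `n × n` box. -/
def boxMatrix (C : ℤ × ℤ → ℤ × ℤ → ℝ) (n : ℕ) : Matrix (Fin n × Fin n) (Fin n × Fin n) ℝ :=
  Matrix.of fun p q ↦ C (boxNode p) (boxNode q)

variable {ζ κ v : ℝ} {C : ℤ × ℤ → ℤ × ℤ → ℝ}

theorem neighbourSum_le {f : ℤ × ℤ → ℝ} {m : ℝ} (h : ∀ s, f s ≤ m) (p : ℤ × ℤ) :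
    neighbourSum f p ≤ 4 * m := by
  unfold neighbourSum
  linarith [h (p.1 + 1, p.2), h (p.1 - 1, p.2), h (p.1, p.2 + 1), h (p.1, p.2 - 1)]

theorem abs_neighbourSum_le (f : ℤ × ℤ → ℝ) (p : ℤ × ℤ) :
    |neighbourSum f p| ≤ neighbourSum (fun s ↦ |f s|) p := by
  unfold neighbourSum
  exact (abs_add_le _ _).trans (add_le_add_left ((abs_add_le _ _).trans
    (add_le_add_left (abs_add_le _ _) _)) _)

theorem sum_neighbourSum {ι : Type*} (t : Finset ι) (f : ι → ℤ × ℤ → ℝ) (p : ℤ × ℤ) :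
    ∑ i ∈ t, neighbourSum (f i) p = neighbourSum (fun s ↦ ∑ i ∈ t, f i s) p := by
  simp only [neighbourSum, Finset.sum_add_distrib]

/-- A maximum principle: `u ≤ ζ · (sum of u over neighbours) + κ⁻¹` gives `(1 - 4ζ) sup u ≤ κ⁻¹`.
The bound `v` serves only to make the supremum finite; it does not enter the estimate, which is
uniform in `n` and `s`. -/
theorem sum_abs_kernel_le (h0 : 0 ≤ ζ) (h1 : ζ < 1 / 4) (hκ : 0 < κ) (hv : ∀ p q, |C p q| ≤ v)
    (hC : ∀ p q, C p q = ζ * neighbourSum (fun s ↦ C s q) p + if p = q then κ⁻¹ else 0)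
    (n : ℕ) (s : ℤ × ℤ) :
    ∑ q : Fin n × Fin n, |C s (boxNode q)| ≤ 1 / (κ * (1 - 4 * ζ)) := by
  set u : ℤ × ℤ → ℝ := fun s ↦ ∑ q : Fin n × Fin n, |C s (boxNode q)| with hu
  have hbdd : BddAbove (Set.range u) := by
    refine ⟨∑ q : Fin n × Fin n, v, ?_⟩
    rintro _ ⟨s, rfl⟩
    exact Finset.sum_le_sum fun q _ ↦ hv _ _
  have hstep : ∀ s, u s ≤ ζ * neighbourSum u s + κ⁻¹ := by
    intro s
    calc u s ≤ ∑ q : Fin n × Fin n, (ζ * neighbourSum (fun s ↦ |C s (boxNode q)|) s +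
          if s = boxNode q then κ⁻¹ else 0) := by
          refine Finset.sum_le_sum fun q _ ↦ ?_
          rw [hC s (boxNode q)]
          refine (abs_add_le _ _).trans (add_le_add ?_ ?_)
          · rw [abs_mul, abs_of_nonneg h0]
            exact mul_le_mul_of_nonneg_left (abs_neighbourSum_le _ _) h0
          · split_ifs
            · rw [abs_of_pos (by positivity)]
            · simp
      _ ≤ ζ * neighbourSum u s + κ⁻¹ := by
          rw [Finset.sum_add_distrib, ← Finset.mul_sum, sum_neighbourSum]
          refine add_le_add le_rfl ?_
          by_cases h : ∃ q : Fin n × Fin n, s = boxNode q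
          · obtain ⟨q, rfl⟩ := h
            simp [boxNode_injective.eq_iff]
          · push Not at h
            rw [Finset.sum_eq_zero fun q _ ↦ if_neg (h q)]
            positivity
  have hsup : ⨆ s, u s ≤ ζ * (4 * ⨆ s, u s) + κ⁻¹ := by
    refine ciSup_le fun s ↦ (hstep s).trans ?_
    gcongr
    exact neighbourSum_le (fun s ↦ le_ciSup hbdd s) s
  refine (le_ciSup hbdd s).trans ?_
  rw [le_div_iff₀ (by nlinarith)]
  have : κ * (⨆ s, u s) ≤ κ * (ζ * (4 * ⨆ s, u s) + κ⁻¹) := by gcongr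
  rw [mul_add, mul_inv_cancel₀ hκ.ne'] at this
  nlinarith

theorem gridMatrix_mul_apply (ζ : ℝ) (n : ℕ) (E : Matrix (Fin n × Fin n) (Fin n × Fin n) ℝ)
    (p q : Fin n × Fin n) :
    (gridMatrix ζ n * E) p q = E p q - ζ * (∑ j, pathAdjacency n p.1 j * E (j, p.2) q +
      ∑ j, pathAdjacency n p.2 j * E (p.1, j) q) := by
  rw [gridMatrix, Matrix.sub_mul, Matrix.one_mul, Matrix.smul_mul, Matrix.add_mul]
  simp only [Matrix.sub_apply, Matrix.smul_apply, Matrix.add_apply, smul_eq_mul]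
  congr 3
  · rw [Matrix.mul_apply, Fintype.sum_prod_type]
    refine Finset.sum_congr rfl fun j _ ↦ ?_
    simp [Matrix.kroneckerMap_apply, Matrix.one_apply]
  · rw [Matrix.mul_apply, Fintype.sum_prod_type]
    simp [Matrix.kroneckerMap_apply, Matrix.one_apply]

/-- Inside the box the lattice equation and the grid matrix cancel; what remains are the neighbours
of boundary nodes lying outside the box. -/
theorem gridMatrix_mul_boxMatrix_apply (n : ℕ) (p q : Fin n × Fin n)
    (hC : ∀ p q, C p q = ζ * neighbourSum (fun s ↦ C s q) p + if p = q then κ⁻¹ else 0) :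
    (gridMatrix ζ n * boxMatrix C n) p q - (if p = q then κ⁻¹ else 0) =
      ζ * ((if p.1.val + 1 = n then C (p.1 + 1, p.2) (boxNode q) else 0) +
        (if p.1.val = 0 then C (p.1 - 1, p.2) (boxNode q) else 0) +
        (if p.2.val + 1 = n then C (p.1, p.2 + 1) (boxNode q) else 0) +
        (if p.2.val = 0 then C (p.1, p.2 - 1) (boxNode q) else 0)) := by
  rw [gridMatrix_mul_apply]
  have e1 := sum_pathAdjacency_mul p.1 fun j ↦ C (j, p.2) (boxNode q)
  have e2 := sum_pathAdjacency_mul p.2 fun j ↦ C (p.1, j) (boxNode q)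
  simp only [boxMatrix, Matrix.of_apply]
  rw [hC (boxNode p) (boxNode q)]
  simp only [boxNode_injective.eq_iff]
  simp only [boxNode, neighbourSum] at e1 e2 ⊢
  rw [e1, e2]
  have l1 := p.1.2
  have l2 := p.2.2
  have s1 : ∀ x : ℝ, (if p.1.val + 1 < n then x else 0) = x - if p.1.val + 1 = n then x else 0 := by
    intro x; split_ifs <;> first | omega | simp
  have s2 : ∀ x : ℝ, (if p.2.val + 1 < n then x else 0) = x - if p.2.val + 1 = n then x else 0 := by
    intro x; split_ifs <;> first | omega | simp
  have s3 : ∀ x : ℝ, (if 0 < p.1.val then x else 0) = x - if p.1.val = 0 then x else 0 := by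
    intro x; split_ifs <;> first | omega | simp
  have s4 : ∀ x : ℝ, (if 0 < p.2.val then x else 0) = x - if p.2.val = 0 then x else 0 := by
    intro x; split_ifs <;> first | omega | simp
  rw [s1, s2, s3, s4]
  ring

/-- There are at most `4 n` missing neighbours, corners counting twice, and each contributes `ζ`
times a kernel row of bounded ℓ¹ norm. -/
theorem sum_abs_gridMatrix_mul_boxMatrix_sub_le (h0 : 0 ≤ ζ) (h1 : ζ < 1 / 4) (hκ : 0 < κ)
    (hv : ∀ p q, |C p q| ≤ v)
    (hC : ∀ p q, C p q = ζ * neighbourSum (fun s ↦ C s q) p + if p = q then κ⁻¹ else 0) (n : ℕ) :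
    ∑ p : Fin n × Fin n, ∑ q : Fin n × Fin n,
      |(gridMatrix ζ n * boxMatrix C n - κ⁻¹ • (1 : Matrix (Fin n × Fin n) (Fin n × Fin n) ℝ)) p q| ≤
      ζ * (1 / (κ * (1 - 4 * ζ))) * (4 * n) := by
  set U := 1 / (κ * (1 - 4 * ζ))
  have hU : ∀ s, ∑ q : Fin n × Fin n, |C s (boxNode q)| ≤ U := sum_abs_kernel_le h0 h1 hκ hv hC n
  have hU0 : 0 ≤ U := (Finset.sum_nonneg fun _ _ ↦ abs_nonneg _).trans (hU 0)
  have hrow : ∀ p : Fin n × Fin n, ∑ q : Fin n × Fin n,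
      |(gridMatrix ζ n * boxMatrix C n - κ⁻¹ • (1 : Matrix (Fin n × Fin n) (Fin n × Fin n) ℝ)) p q| ≤
      ζ * U * ((if p.1.val + 1 = n then 1 else 0) + (if p.1.val = 0 then 1 else 0) +
        (if p.2.val + 1 = n then 1 else 0) + (if p.2.val = 0 then 1 else 0)) := by
    intro p
    have habs : ∀ (P : Prop) [Decidable P] (x : ℝ), |if P then x else 0| = if P then |x| else 0 :=
      fun P _ x ↦ by split_ifs <;> simp
    have hsum : ∀ (P : Prop) [Decidable P] (s : ℤ × ℤ),
        ∑ q : Fin n × Fin n, (if P then |C s (boxNode q)| else 0) ≤ U * if P then 1 else 0 :=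
      fun P _ s ↦ by
        split_ifs
        · simpa using hU s
        · simp
    calc _ ≤ ∑ q : Fin n × Fin n, ζ *
          ((if p.1.val + 1 = n then |C (p.1 + 1, p.2) (boxNode q)| else 0) +
          (if p.1.val = 0 then |C (p.1 - 1, p.2) (boxNode q)| else 0) +
          (if p.2.val + 1 = n then |C (p.1, p.2 + 1) (boxNode q)| else 0) +
          (if p.2.val = 0 then |C (p.1, p.2 - 1) (boxNode q)| else 0)) := by
          refine Finset.sum_le_sum fun q _ ↦ ?_
          have := gridMatrix_mul_boxMatrix_apply n p q hC
          simp only [Matrix.sub_apply, Matrix.smul_apply, Matrix.one_apply, smul_eq_mul, mul_ite,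
            mul_one, mul_zero]
          rw [this, abs_mul, abs_of_nonneg h0]
          simp only [← habs]
          exact mul_le_mul_of_nonneg_left ((abs_add_le _ _).trans (add_le_add_left
            ((abs_add_le _ _).trans (add_le_add_left (abs_add_le _ _) _)) _)) h0
      _ ≤ _ := by
          rw [← Finset.mul_sum, mul_assoc]
          refine mul_le_mul_of_nonneg_left ?_ h0
          simp only [Finset.sum_add_distrib, mul_add]
          exact add_le_add (add_le_add (add_le_add (hsum _ _) (hsum _ _)) (hsum _ _)) (hsum _ _)
  refine (Finset.sum_le_sum fun p _ ↦ hrow p).trans ?_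
  rw [← Finset.mul_sum]
  refine mul_le_mul_of_nonneg_left ?_ (mul_nonneg h0 hU0)
  have hone : ∀ k : ℕ, ∑ i : Fin n, (if i.val = k then (1 : ℝ) else 0) ≤ 1 := fun k ↦ by
    by_cases hk : k < n
    · rw [Finset.sum_eq_single ⟨k, hk⟩]
      · simp
      · intro b _ hb
        rw [if_neg]; exact fun h ↦ hb (Fin.ext h)
      · simp
    · rw [Finset.sum_eq_zero]
      · exact zero_le_one
      · intro b _
        rw [if_neg]
        have := b.2
        omega
  have hone' : ∑ i : Fin n, (if i.val + 1 = n then (1 : ℝ) else 0) ≤ 1 := by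
    refine le_trans (le_of_eq (Finset.sum_congr rfl fun i _ ↦ ?_)) (hone (n - 1))
    have := i.2
    congr 1
    simp only [eq_iff_iff]; omega
  have hfst : ∀ a : Fin n → ℝ, ∑ p : Fin n × Fin n, a p.1 = n * ∑ i, a i := fun a ↦ by
    rw [Fintype.sum_prod_type]; simp [Finset.mul_sum]
  have hsnd : ∀ a : Fin n → ℝ, ∑ p : Fin n × Fin n, a p.2 = n * ∑ i, a i := fun a ↦ by
    rw [Fintype.sum_prod_type]; simp
  simp only [Finset.sum_add_distrib]
  rw [hfst fun i ↦ if i.val + 1 = n then 1 else 0, hfst fun i ↦ if i.val = 0 then 1 else 0,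
    hsnd fun i ↦ if i.val + 1 = n then 1 else 0, hsnd fun i ↦ if i.val = 0 then 1 else 0]
  have hn : (0 : ℝ) ≤ n := n.cast_nonneg
  nlinarith [mul_le_mul_of_nonneg_left (hone 0) hn, mul_le_mul_of_nonneg_left hone' hn]

/-- From `E = G E + ζ A E` with `G` the grid matrix, since the columns of the adjacency matrix sum
to at most 4. For `4ζ < 1` this inverts `G` in ℓ¹ with a constant free of `n`. -/
theorem sum_abs_le_of_gridMatrix_mul (h0 : 0 ≤ ζ) (n : ℕ)
    (E : Matrix (Fin n × Fin n) (Fin n × Fin n) ℝ) :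
    (1 - 4 * ζ) * ∑ p, ∑ q, |E p q| ≤ ∑ p, ∑ q, |(gridMatrix ζ n * E) p q| := by
  have hpq : ∀ p q, |E p q| ≤ |(gridMatrix ζ n * E) p q| +
      ζ * (∑ j, pathAdjacency n p.1 j * |E (j, p.2) q| +
        ∑ j, pathAdjacency n p.2 j * |E (p.1, j) q|) := by
    intro p q
    have h := gridMatrix_mul_apply ζ n E p q
    have h' : E p q = (gridMatrix ζ n * E) p q + ζ * (∑ j, pathAdjacency n p.1 j * E (j, p.2) q +
      ∑ j, pathAdjacency n p.2 j * E (p.1, j) q) := by linarith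
    have h2 := abs_add_le ((gridMatrix ζ n * E) p q)
      (ζ * (∑ j, pathAdjacency n p.1 j * E (j, p.2) q + ∑ j, pathAdjacency n p.2 j * E (p.1, j) q))
    rw [← h'] at h2
    refine h2.trans (add_le_add le_rfl ?_)
    rw [abs_mul, abs_of_nonneg h0]
    refine mul_le_mul_of_nonneg_left ((abs_add_le _ _).trans (add_le_add ?_ ?_)) h0 <;>
    · refine (Finset.abs_sum_le_sum_abs _ _).trans (le_of_eq (Finset.sum_congr rfl fun j _ ↦ ?_))
      rw [abs_mul, abs_of_nonneg (pathAdjacency_nonneg _ _)]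
  have hcol : ∀ f : Fin n → ℝ, (∀ j, 0 ≤ f j) →
      ∑ i, ∑ j, pathAdjacency n i j * f j ≤ 2 * ∑ j, f j := by
    intro f hf
    rw [Finset.sum_comm, Finset.mul_sum]
    refine Finset.sum_le_sum fun j _ ↦ ?_
    rw [← Finset.sum_mul]
    refine mul_le_mul_of_nonneg_right ?_ (hf j)
    simp only [fun i ↦ pathAdjacency_comm i j]
    exact sum_pathAdjacency_le j
  have hA : ∑ p : Fin n × Fin n, ∑ q, ∑ j, pathAdjacency n p.1 j * |E (j, p.2) q| ≤
      2 * ∑ p, ∑ q, |E p q| := by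
    have e : ∀ p : Fin n × Fin n, ∑ q, ∑ j, pathAdjacency n p.1 j * |E (j, p.2) q| =
        ∑ j, pathAdjacency n p.1 j * ∑ q, |E (j, p.2) q| := fun p ↦ by
      rw [Finset.sum_comm]; simp only [Finset.mul_sum]
    simp only [e]
    rw [Fintype.sum_prod_type_right, Fintype.sum_prod_type_right, Finset.mul_sum]
    exact Finset.sum_le_sum fun k _ ↦ hcol (fun j ↦ ∑ q, |E (j, k) q|)
      fun j ↦ Finset.sum_nonneg fun _ _ ↦ abs_nonneg _
  have hB : ∑ p : Fin n × Fin n, ∑ q, ∑ j, pathAdjacency n p.2 j * |E (p.1, j) q| ≤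
      2 * ∑ p, ∑ q, |E p q| := by
    have e : ∀ p : Fin n × Fin n, ∑ q, ∑ j, pathAdjacency n p.2 j * |E (p.1, j) q| =
        ∑ j, pathAdjacency n p.2 j * ∑ q, |E (p.1, j) q| := fun p ↦ by
      rw [Finset.sum_comm]; simp only [Finset.mul_sum]
    simp only [e]
    rw [Fintype.sum_prod_type, Fintype.sum_prod_type, Finset.mul_sum]
    exact Finset.sum_le_sum fun k _ ↦ hcol (fun j ↦ ∑ q, |E (k, j) q|)
      fun j ↦ Finset.sum_nonneg fun _ _ ↦ abs_nonneg _
  have hsum := Finset.sum_le_sum fun (p : Fin n × Fin n) (_ : p ∈ Finset.univ) ↦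
    Finset.sum_le_sum fun (q : Fin n × Fin n) (_ : q ∈ Finset.univ) ↦ hpq p q
  simp only [Finset.sum_add_distrib, ← Finset.mul_sum] at hsum
  nlinarith

/-- The error is of the order of the boundary, `n`, against a volume of `n²`. -/
theorem sum_abs_boxMatrix_sub_le (h0 : 0 ≤ ζ) (h1 : ζ < 1 / 4) (hκ : 0 < κ)
    (hv : ∀ p q, |C p q| ≤ v)
    (hC : ∀ p q, C p q = ζ * neighbourSum (fun s ↦ C s q) p + if p = q then κ⁻¹ else 0) (n : ℕ) :
    ∑ p, ∑ q, |(boxMatrix C n - κ⁻¹ • (gridMatrix ζ n)⁻¹) p q| ≤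
      (4 * ζ / (κ * (1 - 4 * ζ) ^ 2)) * n := by
  have h := sum_abs_le_of_gridMatrix_mul h0 n (boxMatrix C n - κ⁻¹ • (gridMatrix ζ n)⁻¹)
  rw [Matrix.mul_sub, Matrix.mul_smul,
    Matrix.mul_nonsing_inv _ (gridMatrix_posDef h0 h1 n).det_pos.ne'.isUnit] at h
  have h2 := h.trans (sum_abs_gridMatrix_mul_boxMatrix_sub_le h0 h1 hκ hv hC n)
  have h4 : 0 < 1 - 4 * ζ := by linarith
  rw [← le_div_iff₀' h4] at h2
  refine h2.trans (le_of_eq ?_)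
  field_simp

end BoxCovariance

/-! ### Limits of the normalised determinant and trace functionals -/

section Limits

open Matrix

variable {Ω : Type*} [mΩ : MeasurableSpace Ω] {μ : Measure Ω} {X : LatticeField Ω}

theorem IsStationaryGaussianField.boxMatrix_posSemidef (hX : IsStationaryGaussianField X μ) (n : ℕ) :
    (boxMatrix (fieldCov X μ) n).PosSemidef := by
  refine .of_dotProduct_mulVec_nonneg (Matrix.IsHermitian.ext fun p q ↦ ?_) fun x ↦ ?_
  · simp only [boxMatrix, Matrix.of_apply, fieldCov, star_trivial, mul_comm]
  · have h : star x ⬝ᵥ boxMatrix (fieldCov X μ) n *ᵥ x =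
        ∫ ω, (∑ p : Fin n × Fin n, x p * X (boxNode p) ω) ^ 2 ∂μ := by
      simp only [pow_two, Finset.sum_mul_sum]
      have hi : ∀ p q : Fin n × Fin n, Integrable
          (fun ω ↦ x p * X (boxNode p) ω * (x q * X (boxNode q) ω)) μ := fun p q ↦ by
        refine ((hX.integrable_mul (boxNode p) (boxNode q)).const_mul (x p * x q)).congr
          (.of_forall fun ω ↦ ?_)
        simp only; ring
      rw [integral_finsetSum _ fun p _ ↦ integrable_finsetSum _ fun q _ ↦ hi p q]
      simp only [dotProduct, mulVec, star_trivial, Finset.mul_sum]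
      refine Finset.sum_congr rfl fun p _ ↦ ?_
      rw [integral_finsetSum _ fun q _ ↦ hi p q]
      refine Finset.sum_congr rfl fun q _ ↦ ?_
      rw [boxMatrix, Matrix.of_apply, fieldCov, mul_comm _ (x q), ← mul_assoc,
        ← integral_const_mul]
      refine integral_congr_ae (.of_forall fun ω ↦ ?_)
      simp only; ring
    rw [h]
    exact integral_nonneg fun ω ↦ sq_nonneg _

theorem tendsto_div_sq_of_abs_sub_le {a b : ℕ → ℝ} {K L : ℝ} (h : ∀ n, |a n - b n| ≤ K * n)
    (hb : Tendsto (fun n : ℕ ↦ 1 / (n : ℝ) ^ 2 * b n) atTop (𝓝 L)) :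
    Tendsto (fun n : ℕ ↦ 1 / (n : ℝ) ^ 2 * a n) atTop (𝓝 L) := by
  have hK : Tendsto (fun n : ℕ ↦ K * (1 / (n : ℝ))) atTop (𝓝 0) := by
    simpa using tendsto_one_div_atTop_nhds_zero_nat.const_mul K
  have h0 : Tendsto (fun n : ℕ ↦ 1 / (n : ℝ) ^ 2 * (a n - b n)) atTop (𝓝 0) := by
    refine squeeze_zero_norm' ?_ hK
    filter_upwards [eventually_ne_atTop 0] with n hn
    have hn' : (0 : ℝ) < n := by exact_mod_cast Nat.pos_of_ne_zero hn
    rw [norm_mul, Real.norm_eq_abs, Real.norm_eq_abs, abs_of_pos (by positivity)]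
    calc 1 / (n : ℝ) ^ 2 * |a n - b n| ≤ 1 / (n : ℝ) ^ 2 * (K * n) := by
          gcongr; exact h n
      _ = _ := by field_simp
  have := h0.add hb
  rw [zero_add] at this
  exact this.congr fun n ↦ by ring

variable {ι : Type*} [Fintype ι] [DecidableEq ι]

omit [Fintype ι] in
theorem posDef_one_add_smul {S : Matrix ι ι ℝ} (hS : S.PosSemidef) {c : ℝ} (hc : 0 ≤ c) :
    (1 + c • S).PosDef :=
  Matrix.PosDef.one.add_posSemidef (hS.smul hc)

omit [Fintype ι] in
theorem posSemidef_one_add_smul_sub_one {S : Matrix ι ι ℝ} (hS : S.PosSemidef) {c : ℝ}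
    (hc : 0 ≤ c) : (1 + c • S - 1).PosSemidef := by
  rw [add_sub_cancel_left]
  exact hS.smul hc

omit [DecidableEq ι] in
theorem abs_trace_le (M : Matrix ι ι ℝ) : |M.trace| ≤ ∑ p, ∑ q, |M p q| :=
  (Finset.abs_sum_le_sum_abs _ _).trans (Finset.sum_le_sum fun p _ ↦
    Finset.single_le_sum (f := fun q ↦ |M p q|) (fun _ _ ↦ abs_nonneg _) (Finset.mem_univ p))

/-- The Gaussian mutual information of a signal with covariance `S` observed in unit noise. -/
noncomputable def gaussianInfo (B : Matrix ι ι ℝ) : ℝ := 1 / 2 * Real.log B.det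

/-- The Gaussian Kullback-Leibler information of white noise relative to covariance `B`. -/
noncomputable def gaussianKL (B : Matrix ι ι ℝ) : ℝ :=
  1 / 2 * Real.log B.det - 1 / 2 * (Fintype.card ι - B⁻¹.trace)

/-! ### The case of edge dependence below `1/4` -/

section Regular

variable {ζ κ v t s2 : ℝ} {C : ℤ × ℤ → ℤ × ℤ → ℝ}

/-- The function `1 - 2ζ cos x - 2ζ cos y`. -/
noncomputable def gridSymbol (ζ x y : ℝ) : ℝ := 1 - 2 * ζ * Real.cos x - 2 * ζ * Real.cos y

theorem gridSymbol_pos (h0 : 0 ≤ ζ) (h1 : ζ < 1 / 4) (x y : ℝ) : 0 < gridSymbol ζ x y :=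
  one_sub_cos_sub_cos_pos h0 h1 x y

theorem le_gridSymbol (h0 : 0 ≤ ζ) (x y : ℝ) : 1 - 4 * ζ ≤ gridSymbol ζ x y := by
  unfold gridSymbol
  nlinarith [Real.cos_le_one x, Real.cos_le_one y]

/-- The eigenvalues are samples of the symbol at the grid angles, and the symbol is at least `1 -
4ζ`, so only the values of `φ` on `[0, (1 - 4ζ)⁻¹]` matter. -/
theorem tendsto_average_gridSymbol (h0 : 0 ≤ ζ) (h1 : ζ < 1 / 4) {φ : ℝ → ℝ}
    (hφ : ContinuousOn φ (Set.Ici 0)) {a : ℝ} (ha : ∀ x, 0 ≤ x → x ≤ (1 - 4 * ζ)⁻¹ → |φ x| ≤ a) :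
    Tendsto (fun n : ℕ ↦ 1 / (n : ℝ) ^ 2 *
      ∑ p : Fin n × Fin n, φ (gridEigenvalue ζ n p)⁻¹) atTop
      (𝓝 (1 / (4 * Real.pi ^ 2) *
        ∫ x in (-Real.pi)..Real.pi, ∫ y in (-Real.pi)..Real.pi, φ (gridSymbol ζ x y)⁻¹)) := by
  refine tendsto_riemannSum_gridAngle_of_even (F := fun x y ↦ φ (gridSymbol ζ x y)⁻¹) (C := a)
    ?_ (fun x y ↦ ?_) (fun x y ↦ ?_) (fun x y ↦ ?_)
  · have hc : Continuous fun x : ℝ × ℝ ↦ (gridSymbol ζ x.1 x.2)⁻¹ := by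
      refine Continuous.inv₀ ?_ fun x ↦ (gridSymbol_pos h0 h1 _ _).ne'
      unfold gridSymbol
      fun_prop
    exact hφ.comp_continuous hc fun x ↦ inv_nonneg.2 (gridSymbol_pos h0 h1 _ _).le
  · exact ha _ (inv_nonneg.2 (gridSymbol_pos h0 h1 _ _).le)
      (inv_anti₀ (by linarith) (le_gridSymbol h0 x y))
  · simp [gridSymbol]
  · simp [gridSymbol]

/-- The constant diagonal makes the normalised trace of the box covariance equal to `v`, while
comparison with the grid model gives the limit `κ⁻¹` times the mean of the inverse symbol. -/
theorem variance_eq_ellipticK (h0 : 0 ≤ ζ) (h1 : ζ < 1 / 4) (hκ : 0 < κ)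
    (hv : ∀ p q, |C p q| ≤ v) (hself : ∀ p, C p p = v)
    (hC : ∀ p q, C p q = ζ * neighbourSum (fun s ↦ C s q) p + if p = q then κ⁻¹ else 0) :
    v = κ⁻¹ * (2 / Real.pi * (ellipticK (4 * ζ)).toReal) := by
  have hlim := (tendsto_average_gridSymbol h0 h1 (φ := fun x ↦ x) continuousOn_id
    (a := (1 - 4 * ζ)⁻¹) (fun x hx hx' ↦ by rwa [abs_of_nonneg hx])).const_mul κ⁻¹
  simp only [gridSymbol] at hlim
  rw [average_one_div_eq_ellipticK h0 h1] at hlim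
  have hlim' := tendsto_div_sq_of_abs_sub_le (a := fun n ↦ (boxMatrix C n).trace)
    (b := fun n ↦ κ⁻¹ * ∑ p : Fin n × Fin n, (gridEigenvalue ζ n p)⁻¹) (fun n ↦ by
      have h := (abs_trace_le _).trans (sum_abs_boxMatrix_sub_le h0 h1 hκ hv hC n)
      rwa [Matrix.trace_sub, Matrix.trace_smul, trace_gridMatrix_inv h0 h1, smul_eq_mul] at h)
    (hlim.congr fun n ↦ by ring)
  refine tendsto_nhds_unique (tendsto_const_nhds.congr' ?_) hlim'
  filter_upwards [eventually_ne_atTop 0] with n hn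
  have hn' : (n : ℝ) ≠ 0 := by exact_mod_cast hn
  simp [Matrix.trace, boxMatrix, hself]
  field_simp

theorem abs_gaussianInfo_sub_le {B B' : Matrix ι ι ℝ} (hB : B.PosDef) (hB1 : (B - 1).PosSemidef)
    (hB' : B'.PosDef) (hB1' : (B' - 1).PosSemidef) :
    |gaussianInfo B' - gaussianInfo B| ≤ ∑ p, ∑ q, |(B' - B) p q| := by
  have h1 := abs_log_det_sub_le hB hB1 hB' hB1'
  unfold gaussianInfo
  rw [← mul_sub, abs_mul, abs_of_pos (by norm_num : (0 : ℝ) < 1 / 2)]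
  have := abs_nonneg (Real.log B'.det - Real.log B.det)
  linarith

theorem abs_gaussianKL_sub_le {B B' : Matrix ι ι ℝ} (hB : B.PosDef) (hB1 : (B - 1).PosSemidef)
    (hB' : B'.PosDef) (hB1' : (B' - 1).PosSemidef) :
    |gaussianKL B' - gaussianKL B| ≤ ∑ p, ∑ q, |(B' - B) p q| := by
  have h1 := abs_log_det_sub_le hB hB1 hB' hB1'
  have h2 := abs_trace_inv_sub_le hB hB1 hB' hB1'
  unfold gaussianKL
  rw [abs_le] at *
  constructor <;> linarith

theorem sum_abs_one_add_smul_boxMatrix_sub_le (h0 : 0 ≤ ζ) (h1 : ζ < 1 / 4) (hκ : 0 < κ)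
    (hv : ∀ p q, |C p q| ≤ v)
    (hC : ∀ p q, C p q = ζ * neighbourSum (fun s ↦ C s q) p + if p = q then κ⁻¹ else 0)
    {c : ℝ} (hc : 0 ≤ c) (n : ℕ) :
    ∑ p, ∑ q, |((1 + c • boxMatrix C n) - (1 + (c * κ⁻¹) • (gridMatrix ζ n)⁻¹)) p q| ≤
      (c * (4 * ζ / (κ * (1 - 4 * ζ) ^ 2))) * n := by
  have h := sum_abs_boxMatrix_sub_le h0 h1 hκ hv hC n
  have habs : ∀ p q : Fin n × Fin n,
      |((1 + c • boxMatrix C n) - (1 + (c * κ⁻¹) • (gridMatrix ζ n)⁻¹)) p q| =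
        c * |(boxMatrix C n - κ⁻¹ • (gridMatrix ζ n)⁻¹) p q| := fun p q ↦ by
    rw [add_sub_add_left_eq_sub, mul_smul, ← smul_sub, Matrix.smul_apply, smul_eq_mul, abs_mul,
      abs_of_nonneg hc]
  simp only [habs, ← Finset.mul_sum]
  rw [mul_assoc]
  exact mul_le_mul_of_nonneg_left h hc

theorem tendsto_gaussianInfo_boxMatrix (h0 : 0 ≤ ζ) (h1 : ζ < 1 / 4) (hκ : 0 < κ)
    (hv : ∀ p q, |C p q| ≤ v) (hpsd : ∀ n, (boxMatrix C n).PosSemidef)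
    (hC : ∀ p q, C p q = ζ * neighbourSum (fun s ↦ C s q) p + if p = q then κ⁻¹ else 0)
    {c : ℝ} (hc : 0 ≤ c) :
    Tendsto (fun n : ℕ ↦ 1 / (n : ℝ) ^ 2 * gaussianInfo (1 + c • boxMatrix C n)) atTop
      (𝓝 (1 / (4 * Real.pi ^ 2) * ∫ x in (-Real.pi)..Real.pi, ∫ y in (-Real.pi)..Real.pi,
        1 / 2 * Real.log (1 + c * κ⁻¹ * (gridSymbol ζ x y)⁻¹))) := by
  have ht : 0 ≤ c * κ⁻¹ := by positivity
  have hM := fun n ↦ (gridMatrix_posDef h0 h1 n).inv.posSemidef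
  refine tendsto_div_sq_of_abs_sub_le (fun n ↦ (abs_gaussianInfo_sub_le
    (posDef_one_add_smul (hM n) ht) (posSemidef_one_add_smul_sub_one (hM n) ht)
    (posDef_one_add_smul (hpsd n) hc) (posSemidef_one_add_smul_sub_one (hpsd n) hc)).trans
    (sum_abs_one_add_smul_boxMatrix_sub_le h0 h1 hκ hv hC hc n)) ?_
  refine (tendsto_average_gridSymbol h0 h1 (φ := fun x ↦ 1 / 2 * Real.log (1 + c * κ⁻¹ * x))
    (a := 1 / 2 * (c * κ⁻¹ * (1 - 4 * ζ)⁻¹)) ?_ fun x hx hx' ↦ ?_).congr fun n ↦ ?_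
  · refine continuousOn_const.mul (ContinuousOn.log (by fun_prop) fun x (hx : 0 ≤ x) ↦ ?_)
    positivity
  · have hx1 : 0 ≤ c * κ⁻¹ * x := by positivity
    rw [abs_of_nonneg (mul_nonneg (by norm_num) (Real.log_nonneg (by linarith)))]
    have h2 := Real.log_le_sub_one_of_pos (x := 1 + c * κ⁻¹ * x) (by linarith)
    have h3 := mul_le_mul_of_nonneg_left hx' ht
    linarith
  · rw [gaussianInfo, log_det_one_add_smul_gridMatrix_inv h0 h1 ht, ← Finset.mul_sum]
    simp [div_eq_mul_inv]

theorem tendsto_gaussianKL_boxMatrix (h0 : 0 ≤ ζ) (h1 : ζ < 1 / 4) (hκ : 0 < κ)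
    (hv : ∀ p q, |C p q| ≤ v) (hpsd : ∀ n, (boxMatrix C n).PosSemidef)
    (hC : ∀ p q, C p q = ζ * neighbourSum (fun s ↦ C s q) p + if p = q then κ⁻¹ else 0)
    {c : ℝ} (hc : 0 ≤ c) :
    Tendsto (fun n : ℕ ↦ 1 / (n : ℝ) ^ 2 * gaussianKL (1 + c • boxMatrix C n)) atTop
      (𝓝 (1 / (4 * Real.pi ^ 2) * ∫ x in (-Real.pi)..Real.pi, ∫ y in (-Real.pi)..Real.pi,
        (1 / 2 * Real.log (1 + c * κ⁻¹ * (gridSymbol ζ x y)⁻¹) -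
          1 / 2 * (1 - 1 / (1 + c * κ⁻¹ * (gridSymbol ζ x y)⁻¹))))) := by
  have ht : 0 ≤ c * κ⁻¹ := by positivity
  have hM := fun n ↦ (gridMatrix_posDef h0 h1 n).inv.posSemidef
  refine tendsto_div_sq_of_abs_sub_le (fun n ↦ (abs_gaussianKL_sub_le
    (posDef_one_add_smul (hM n) ht) (posSemidef_one_add_smul_sub_one (hM n) ht)
    (posDef_one_add_smul (hpsd n) hc) (posSemidef_one_add_smul_sub_one (hpsd n) hc)).trans
    (sum_abs_one_add_smul_boxMatrix_sub_le h0 h1 hκ hv hC hc n)) ?_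
  refine (tendsto_average_gridSymbol h0 h1 (φ := fun x ↦ 1 / 2 * Real.log (1 + c * κ⁻¹ * x) -
    1 / 2 * (1 - 1 / (1 + c * κ⁻¹ * x)))
    (a := 1 / 2 * (c * κ⁻¹ * (1 - 4 * ζ)⁻¹) + 1 / 2) ?_ fun x hx hx' ↦ ?_).congr fun n ↦ ?_
  · refine (continuousOn_const.mul (ContinuousOn.log (by fun_prop) fun x (hx : 0 ≤ x) ↦ ?_)).sub
      (continuousOn_const.mul (continuousOn_const.sub (continuousOn_const.div (by fun_prop)
        fun x (hx : 0 ≤ x) ↦ ?_))) <;>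
    positivity
  · have hx1 : 0 ≤ c * κ⁻¹ * x := by positivity
    have h2 := Real.log_le_sub_one_of_pos (x := 1 + c * κ⁻¹ * x) (by linarith)
    have h2' := Real.log_nonneg (x := 1 + c * κ⁻¹ * x) (by linarith)
    have h3 := mul_le_mul_of_nonneg_left hx' ht
    have h4 : 1 / (1 + c * κ⁻¹ * x) ≤ 1 := by
      rw [div_le_one (by linarith)]; linarith
    have h5 : 0 ≤ 1 / (1 + c * κ⁻¹ * x) := by positivity
    rw [abs_le]
    constructor <;> linarith
  · rw [gaussianKL, log_det_one_add_smul_gridMatrix_inv h0 h1 ht,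
      trace_inv_one_add_smul_gridMatrix_inv h0 h1 ht, Finset.sum_sub_distrib, ← Finset.mul_sum,
      ← Finset.mul_sum, Finset.sum_sub_distrib]
    simp [div_eq_mul_inv]

/-- The elliptic integral is finite and positive here, so it cancels against the one in the signal
power. -/
theorem snrQuotient_eq (h0 : 0 ≤ ζ) (h1 : ζ < 1 / 4) (hκ : 0 < κ) (hs : 0 < s2)
    (hv : v = κ⁻¹ * (2 / Real.pi * (ellipticK (4 * ζ)).toReal)) (x y : ℝ) :
    snrQuotient (v / s2) ζ x y = s2⁻¹ * κ⁻¹ * (gridSymbol ζ x y)⁻¹ := by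
  have hk : |4 * ζ| < 1 := by rw [abs_of_nonneg (by linarith)]; linarith
  have hK : 0 < (ellipticK (4 * ζ)).toReal := by
    rw [ellipticK_eq_ofReal hk, ENNReal.toReal_ofReal_eq_iff.2]
    · refine intervalIntegral.intervalIntegral_pos_of_pos
        ((continuous_one_div_sqrt_one_sub_mul_sin hk).intervalIntegrable _ _) (fun θ ↦ ?_)
        (by positivity)
      have h2 : (4 * ζ) ^ 2 < 1 := (sq_lt_one_iff_abs_lt_one _).2 hk
      have : 0 < 1 - (4 * ζ) ^ 2 * Real.sin θ ^ 2 := by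
        nlinarith [Real.sin_sq_le_one θ, sq_nonneg (4 * ζ)]
      positivity
    · exact intervalIntegral.integral_nonneg (by positivity) fun θ _ ↦ by positivity
  have hp := gridSymbol_pos h0 h1 x y
  have hv0 : 0 ≤ v / s2 := by rw [hv]; positivity
  have hpi := Real.pi_pos
  unfold snrQuotient
  change (_ / (_ * _ * ENNReal.ofReal (gridSymbol ζ x y))).toReal = _
  rw [ENNReal.toReal_div, ENNReal.toReal_mul, ENNReal.toReal_mul, ENNReal.toReal_ofReal hv0,
    ENNReal.toReal_ofReal hp.le, ENNReal.toReal_ofReal (by positivity), hv]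
  field_simp

end Regular

/-! ### The perfectly correlated case -/

section Degenerate

theorem snrQuotient_one_fourth (snr x y : ℝ) : snrQuotient snr (1 / 4) x y = 0 := by
  have hpi : ENNReal.ofReal (2 / Real.pi) ≠ 0 := by
    simp [Real.pi_pos]
  rw [snrQuotient, show (4 : ℝ) * (1 / 4) = 1 by norm_num, ellipticK_one, ENNReal.mul_top hpi]
  rcases eq_or_ne (ENNReal.ofReal (1 - 2 * (1 / 4) * Real.cos x - 2 * (1 / 4) * Real.cos y)) 0 with
    h | h
  -- On the exceptional set `cos x + cos y = 2` the denominator is `∞ · 0 = 0`; after `toReal` the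
  -- quotient is a real division by zero, hence again 0.
  · rw [h, mul_zero, ENNReal.toReal_div]
    simp
  · rw [ENNReal.top_mul h]
    simp

variable {v c : ℝ}

theorem det_one_add_smul_const (a : ℝ) :
    (1 + Matrix.of fun _ _ : ι ↦ a).det = 1 + Fintype.card ι * a := by
  have h : (Matrix.of fun _ _ : ι ↦ a) =
      Matrix.replicateCol Unit (fun _ : ι ↦ a) * Matrix.replicateRow Unit (fun _ : ι ↦ (1 : ℝ)) := by
    ext i j; simp [Matrix.mul_apply]
  rw [h, Matrix.det_one_add_replicateCol_mul_replicateRow]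
  simp [dotProduct]

/-- The tangent inequality at `B`, evaluated at the identity. -/
theorem card_sub_trace_inv_le_log_det {B : Matrix ι ι ℝ} (hB : B.PosDef) :
    Fintype.card ι - B⁻¹.trace ≤ Real.log B.det := by
  have h := log_det_sub_log_det_le hB Matrix.PosDef.one
  rw [Matrix.mul_sub, Matrix.mul_one, Matrix.nonsing_inv_mul _ hB.det_pos.ne'.isUnit,
    Matrix.trace_sub, Matrix.trace_one, Matrix.det_one, Real.log_one] at h
  linarith

theorem trace_inv_le_card {B : Matrix ι ι ℝ} (hB : B.PosDef) (hB1 : (B - 1).PosSemidef) :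
    B⁻¹.trace ≤ Fintype.card ι := by
  have : B⁻¹.trace ≤ ∑ _i : ι, (1 : ℝ) :=
    Finset.sum_le_sum fun i _ ↦ (le_abs_self _).trans (abs_inv_apply_le_one hB hB1 i i)
  simpa using this

theorem log_one_add_natCast_sq_mul_le {a : ℝ} (ha : 0 ≤ a) (n : ℕ) :
    Real.log (1 + n * n * a) ≤ (Real.log (1 + a) + 2) * n := by
  rcases Nat.eq_zero_or_pos n with rfl | hn
  · simp
  · have hn' : (1 : ℝ) ≤ n := by exact_mod_cast hn
    have h1 : Real.log (1 + n * n * a) ≤ Real.log ((1 + a) * (n * n)) := by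
      refine Real.log_le_log (by positivity) ?_
      nlinarith
    rw [Real.log_mul (by positivity) (by positivity), Real.log_mul (by positivity) (by positivity)]
      at h1
    have h2 := Real.log_le_sub_one_of_pos (x := (n : ℝ)) (by linarith)
    have h3 := Real.log_nonneg (x := 1 + a) (by linarith)
    nlinarith

variable {C : ℤ × ℤ → ℤ × ℤ → ℝ}

theorem log_det_one_add_smul_boxMatrix_const (hC : ∀ p q, C p q = v) (n : ℕ) :
    Real.log (1 + c • boxMatrix C n).det = Real.log (1 + n * n * (c * v)) := by
  have h : c • boxMatrix C n = Matrix.of fun _ _ ↦ c * v := by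
    ext p q; simp [boxMatrix, hC]
  rw [h, det_one_add_smul_const]
  simp

theorem tendsto_gaussianInfo_boxMatrix_const (hC : ∀ p q, C p q = v) (hv : 0 ≤ v) (hc : 0 ≤ c) :
    Tendsto (fun n : ℕ ↦ 1 / (n : ℝ) ^ 2 * gaussianInfo (1 + c • boxMatrix C n)) atTop (𝓝 0) := by
  have hcv : 0 ≤ c * v := mul_nonneg hc hv
  refine tendsto_div_sq_of_abs_sub_le (b := 0) (K := Real.log (1 + c * v) + 2) (fun n ↦ ?_) (by simp)
  have h1 := log_one_add_natCast_sq_mul_le hcv n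
  have h2 := Real.log_nonneg (x := 1 + n * n * (c * v)) (by
    have : 0 ≤ n * n * (c * v) := by positivity
    linarith)
  rw [gaussianInfo, log_det_one_add_smul_boxMatrix_const hC, Pi.zero_apply, sub_zero,
    abs_of_nonneg (by linarith)]
  linarith

/-- Here `0 ≤ card - tr B⁻¹ ≤ log det B`, so the functional lies between 0 and `½ log det B = ½ log
(1 + n² c v)`. -/
theorem tendsto_gaussianKL_boxMatrix_const (hC : ∀ p q, C p q = v) (hv : 0 ≤ v) (hc : 0 ≤ c)
    (hpsd : ∀ n, (boxMatrix C n).PosSemidef) :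
    Tendsto (fun n : ℕ ↦ 1 / (n : ℝ) ^ 2 * gaussianKL (1 + c • boxMatrix C n)) atTop (𝓝 0) := by
  have hcv : 0 ≤ c * v := mul_nonneg hc hv
  refine tendsto_div_sq_of_abs_sub_le (b := 0) (K := Real.log (1 + c * v) + 2) (fun n ↦ ?_) (by simp)
  have h1 := log_one_add_natCast_sq_mul_le hcv n
  have h3 := card_sub_trace_inv_le_log_det (posDef_one_add_smul (hpsd n) hc)
  have h4 := trace_inv_le_card (posDef_one_add_smul (hpsd n) hc)
    (posSemidef_one_add_smul_sub_one (hpsd n) hc)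
  rw [log_det_one_add_smul_boxMatrix_const hC] at h3
  rw [gaussianKL, log_det_one_add_smul_boxMatrix_const hC, Pi.zero_apply, sub_zero,
    abs_of_nonneg (by linarith)]
  linarith

end Degenerate

end Limits

/-! ### Densities of Gaussian vectors in rotated coordinates -/

section GaussianDensity

open Matrix

theorem map_withDensity_comp {α β : Type*} [MeasurableSpace α] [MeasurableSpace β] {μ : Measure α}
    {ν : Measure β} (e : α ≃ᵐ β) (he : MeasurePreserving e μ ν) {g : β → ℝ≥0∞} (hg : Measurable g) :
    (μ.withDensity (g ∘ e)).map e = ν.withDensity g := by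
  ext s hs
  rw [Measure.map_apply e.measurable hs, withDensity_apply _ (e.measurable hs),
    withDensity_apply _ hs]
  exact he.setLIntegral_comp_preimage hs hg

variable {ι : Type*} [Fintype ι]

theorem pi_gaussianReal_eq_withDensity {s : ι → ℝ≥0} (hs : ∀ i, s i ≠ 0) :
    Measure.pi (fun i ↦ gaussianReal 0 (s i)) =
      volume.withDensity fun x ↦ ENNReal.ofReal (∏ i, gaussianPDFReal 0 (s i) (x i)) := by
  refine Measure.pi_eq fun t ht ↦ ?_
  rw [withDensity_apply _ (MeasurableSet.univ_pi ht), volume_pi, Measure.restrict_pi_pi,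
    ← ofReal_integral_eq_lintegral_ofReal]
  · rw [integral_fintype_prod_eq_prod, ENNReal.ofReal_prod_of_nonneg]
    · exact Finset.prod_congr rfl fun i _ ↦ (gaussianReal_apply_eq_integral 0 (hs i) _).symm
    · exact fun i _ ↦ integral_nonneg fun x ↦ gaussianPDFReal_nonneg _ _ _
  · exact Integrable.fintype_prod fun i ↦ (integrable_gaussianPDFReal 0 (s i)).restrict
  · exact .of_forall fun x ↦ Finset.prod_nonneg fun i _ ↦ gaussianPDFReal_nonneg _ _ _

variable [DecidableEq ι]

/-- The multiplication by an orthogonal matrix, as a measurable equivalence. -/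
def orthogonalEquiv (U : Matrix ι ι ℝ) (h : U * Uᵀ = 1) (h' : Uᵀ * U = 1) : (ι → ℝ) ≃ᵐ (ι → ℝ) where
  toFun x := U *ᵥ x
  invFun x := Uᵀ *ᵥ x
  left_inv x := by simp [h']
  right_inv x := by simp [h]
  measurable_toFun := by
    change Measurable fun x ↦ U *ᵥ x
    fun_prop
  measurable_invFun := by
    change Measurable fun x ↦ Uᵀ *ᵥ x
    fun_prop

theorem measurePreserving_orthogonalEquiv (U : Matrix ι ι ℝ) (h : U * Uᵀ = 1) (h' : Uᵀ * U = 1) :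
    MeasurePreserving (orthogonalEquiv U h h') volume volume := by
  refine ⟨(orthogonalEquiv U h h').measurable, ?_⟩
  have hdet : U.det * U.det = 1 := by
    have := congrArg Matrix.det h
    rwa [Matrix.det_mul, Matrix.det_transpose, Matrix.det_one] at this
  have habs : |(U.det)⁻¹| = 1 := by
    rw [abs_inv, inv_eq_one]
    rcases mul_self_eq_one_iff.1 hdet with h | h <;> simp [h]
  have hne : U.det ≠ 0 := fun h0 ↦ by simp [h0] at hdet
  have := Real.map_matrix_volume_pi_eq_smul_volume_pi hne
  rw [habs, ENNReal.ofReal_one, one_smul] at this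
  exact this

/-- The centered Gaussian density with variances `s` along the columns of the matrix `U`. -/
noncomputable def rotatedGaussianPDF (U : Matrix ι ι ℝ) (s : ι → ℝ≥0) (y : ι → ℝ) : ℝ :=
  ∏ k, gaussianPDFReal 0 (s k) ((Uᵀ *ᵥ y) k)

omit [DecidableEq ι] in
theorem measurable_rotatedGaussianPDF (U : Matrix ι ι ℝ) (s : ι → ℝ≥0) :
    Measurable (rotatedGaussianPDF U s) := by
  refine Finset.measurable_fun_prod _ fun k _ ↦ (measurable_gaussianPDFReal 0 (s k)).comp ?_
  fun_prop

omit [DecidableEq ι] in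
theorem rotatedGaussianPDF_pos (U : Matrix ι ι ℝ) {s : ι → ℝ≥0} (hs : ∀ k, s k ≠ 0) (y : ι → ℝ) :
    0 < rotatedGaussianPDF U s y :=
  Finset.prod_pos fun k _ ↦ gaussianPDFReal_pos _ _ _ (hs k)

omit [DecidableEq ι] in
theorem log_rotatedGaussianPDF (U : Matrix ι ι ℝ) {s : ι → ℝ≥0} (hs : ∀ k, s k ≠ 0) (y : ι → ℝ) :
    Real.log (rotatedGaussianPDF U s y) =
      ∑ k, (-(1 / 2 * Real.log (2 * Real.pi * s k)) - (Uᵀ *ᵥ y) k ^ 2 / (2 * s k)) := by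
  rw [rotatedGaussianPDF, Real.log_prod fun k _ ↦ (gaussianPDFReal_pos _ _ _ (hs k)).ne']
  refine Finset.sum_congr rfl fun k _ ↦ ?_
  have h0 : (0 : ℝ) < s k := by exact_mod_cast pos_iff_ne_zero.2 (hs k)
  have h1 : 0 < 2 * Real.pi * s k := by have := Real.pi_pos; positivity
  rw [gaussianPDFReal_def]
  simp only
  rw [Real.log_mul (by positivity) (Real.exp_pos _).ne', Real.log_exp, Real.log_inv,
    Real.log_sqrt h1.le, sub_zero]
  ring

variable {Ω : Type*} [mΩ : MeasurableSpace Ω] {μ : Measure Ω} [IsProbabilityMeasure μ]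

/-- A centered Gaussian vector whose covariance matrix is diagonalised by the orthogonal matrix `U`,
with positive eigenvalues `s`. -/
structure IsDiagonalisedGaussian (V : ι → Ω → ℝ) (U : Matrix ι ι ℝ) (s : ι → ℝ≥0) (μ : Measure Ω) :
    Prop where
  measurable : ∀ i, Measurable (V i)
  gaussian : HasGaussianLaw (fun ω i ↦ V i ω) μ
  mean : ∀ i, ∫ ω, V i ω ∂μ = 0
  orthogonal : U * Uᵀ = 1
  pos : ∀ k, s k ≠ 0
  cov : Uᵀ * Matrix.of (fun i j ↦ ∫ ω, V i ω * V j ω ∂μ) * U = diagonal fun k ↦ (s k : ℝ)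

namespace IsDiagonalisedGaussian

variable {V : ι → Ω → ℝ} {U : Matrix ι ι ℝ} {s : ι → ℝ≥0}

omit [IsProbabilityMeasure μ]

theorem orthogonal' (h : IsDiagonalisedGaussian V U s μ) : Uᵀ * U = 1 :=
  mul_eq_one_comm.1 h.orthogonal

theorem gaussian_rotate (h : IsDiagonalisedGaussian V U s μ) :
    HasGaussianLaw (fun ω k ↦ (Uᵀ *ᵥ fun i ↦ V i ω) k) μ :=
  h.gaussian.map (Matrix.toLin' Uᵀ).toContinuousLinearMap

theorem measurable_rotate (h : IsDiagonalisedGaussian V U s μ) (k : ι) :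
    Measurable fun ω ↦ (Uᵀ *ᵥ fun i ↦ V i ω) k := by
  have := h.measurable
  simp only [mulVec, dotProduct]
  fun_prop

theorem integral_rotate_mul (h : IsDiagonalisedGaussian V U s μ) (k l : ι) :
    ∫ ω, (Uᵀ *ᵥ fun i ↦ V i ω) k * (Uᵀ *ᵥ fun i ↦ V i ω) l ∂μ = if k = l then (s k : ℝ) else 0 := by
  have hc := congrFun (congrFun h.cov k) l
  rw [Matrix.diagonal_apply] at hc
  rw [← hc]
  have hi : ∀ i j, Integrable (fun ω ↦ Uᵀ k i * V i ω * (Uᵀ l j * V j ω)) μ := fun i j ↦ by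
    have h2 := ((h.gaussian.eval i).memLp_two.integrable_mul (h.gaussian.eval j).memLp_two)
    refine (h2.const_mul (Uᵀ k i * Uᵀ l j)).congr (.of_forall fun ω ↦ ?_)
    simp only [Pi.mul_apply]; ring
  simp only [mulVec, dotProduct, Finset.sum_mul_sum]
  rw [integral_finsetSum _ fun p _ ↦ integrable_finsetSum _ fun q _ ↦ hi p q]
  simp only [Matrix.mul_apply, Finset.sum_mul, Matrix.of_apply]
  rw [Finset.sum_comm]
  refine Finset.sum_congr rfl fun i _ ↦ ?_
  rw [integral_finsetSum _ fun q _ ↦ hi i q]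
  refine Finset.sum_congr rfl fun j _ ↦ ?_
  rw [mul_assoc, mul_comm _ (U j l), ← mul_assoc, ← integral_const_mul]
  refine integral_congr_ae (.of_forall fun ω ↦ ?_)
  simp only [Matrix.transpose_apply]; ring

theorem integral_rotate (h : IsDiagonalisedGaussian V U s μ) (k : ι) :
    ∫ ω, (Uᵀ *ᵥ fun i ↦ V i ω) k ∂μ = 0 := by
  simp only [mulVec, dotProduct]
  rw [integral_finsetSum _ fun i _ ↦ (h.gaussian.eval i).integrable.const_mul _]
  simp [integral_const_mul, h.mean]

theorem memLp_rotate (h : IsDiagonalisedGaussian V U s μ) (k : ι) :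
    MemLp (fun ω ↦ (Uᵀ *ᵥ fun i ↦ V i ω) k) 2 μ :=
  (h.gaussian_rotate.eval k).memLp_two

theorem iIndepFun_rotate [IsProbabilityMeasure μ] (h : IsDiagonalisedGaussian V U s μ) :
    iIndepFun (fun k ω ↦ (Uᵀ *ᵥ fun i ↦ V i ω) k) μ := by
  refine h.gaussian_rotate.iIndepFun_of_covariance_eq_zero fun k l hkl ↦ ?_
  rw [covariance_eq_sub (h.memLp_rotate k) (h.memLp_rotate l), h.integral_rotate, zero_mul, sub_zero]
  exact (h.integral_rotate_mul k l).trans (if_neg hkl)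

theorem map_rotate_apply [IsProbabilityMeasure μ] (h : IsDiagonalisedGaussian V U s μ) (k : ι) :
    μ.map (fun ω ↦ (Uᵀ *ᵥ fun i ↦ V i ω) k) = gaussianReal 0 (s k) := by
  rw [(h.gaussian_rotate.eval k).map_eq_gaussianReal, h.integral_rotate,
    variance_of_integral_eq_zero (h.measurable_rotate k).aemeasurable (h.integral_rotate k)]
  have := h.integral_rotate_mul k k
  rw [if_pos rfl] at this
  simp only [pow_two, this, Real.toNNReal_coe]

/-- The coordinates along the columns of `U` are jointly Gaussian and uncorrelated, hence
independent; rotating back preserves Lebesgue measure. -/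
theorem map_eq [IsProbabilityMeasure μ] (h : IsDiagonalisedGaussian V U s μ) :
    μ.map (fun ω i ↦ V i ω) =
      volume.withDensity fun y ↦ ENNReal.ofReal (rotatedGaussianPDF U s y) := by
  have hZ : μ.map (fun ω k ↦ (Uᵀ *ᵥ fun i ↦ V i ω) k) =
      Measure.pi fun k ↦ gaussianReal 0 (s k) := by
    rw [h.iIndepFun_rotate.map_fun_eq_pi_map fun k ↦ (h.measurable_rotate k).aemeasurable]
    simp only [h.map_rotate_apply]
  rw [pi_gaussianReal_eq_withDensity h.pos] at hZ
  have hV : (fun ω i ↦ V i ω) = (orthogonalEquiv U h.orthogonal h.orthogonal') ∘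
      fun ω k ↦ (Uᵀ *ᵥ fun i ↦ V i ω) k := by
    ext1 ω
    change (fun i ↦ V i ω) = U *ᵥ (Uᵀ *ᵥ fun i ↦ V i ω)
    rw [Matrix.mulVec_mulVec, h.orthogonal, Matrix.one_mulVec]
  rw [hV, ← Measure.map_map (MeasurableEquiv.measurable _)
    (measurable_pi_lambda _ h.measurable_rotate), hZ,
    ← map_withDensity_comp _ (measurePreserving_orthogonalEquiv U h.orthogonal h.orthogonal')
      (measurable_rotatedGaussianPDF U s).ennreal_ofReal]
  congr 2
  ext1 x
  change _ = ENNReal.ofReal (∏ k, gaussianPDFReal 0 (s k) ((Uᵀ *ᵥ (U *ᵥ x)) k))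
  rw [Matrix.mulVec_mulVec, h.orthogonal', Matrix.one_mulVec]

end IsDiagonalisedGaussian

end GaussianDensity

/-! ### The Gaussian channel on a finite index set -/

section GaussianChannel

open Matrix

variable {ι : Type*} [Fintype ι] [DecidableEq ι]

theorem exists_orthogonal_diagonalisation {B : Matrix ι ι ℝ} (hB : B.IsHermitian)
    (hB1 : (B - 1).PosSemidef) :
    ∃ (U : Matrix ι ι ℝ) (b : ι → ℝ), U * Uᵀ = 1 ∧ B * U = U * diagonal b ∧ ∀ k, 1 ≤ b k := by
  set U : Matrix ι ι ℝ := (hB.eigenvectorUnitary : Matrix ι ι ℝ) with hU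
  have h1 : U * Uᵀ = 1 := by
    have := Unitary.coe_mul_star_self hB.eigenvectorUnitary
    rwa [Unitary.coe_star, Matrix.star_eq_conjTranspose, Matrix.conjTranspose_eq_transpose_of_trivial] at this
  have h1' : Uᵀ * U = 1 := mul_eq_one_comm.1 h1
  have h2 : B = U * diagonal hB.eigenvalues * Uᵀ := by
    have := hB.spectral_theorem
    rw [Unitary.conjStarAlgAut_apply, Matrix.star_eq_conjTranspose,
      Matrix.conjTranspose_eq_transpose_of_trivial] at this
    exact this
  have h3 : B * U = U * diagonal hB.eigenvalues := by
    conv_lhs => rw [h2, Matrix.mul_assoc, h1', Matrix.mul_one]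
  refine ⟨U, hB.eigenvalues, h1, h3, fun k ↦ ?_⟩
  have h4 := hB1.conjTranspose_mul_mul_same U
  rw [Matrix.conjTranspose_eq_transpose_of_trivial, Matrix.mul_sub, Matrix.mul_one, Matrix.sub_mul,
    Matrix.mul_assoc, h3, ← Matrix.mul_assoc, h1', Matrix.one_mul] at h4
  have := h4.diag_nonneg (i := k)
  simp at this
  exact this

variable {Ω : Type*} [mΩ : MeasurableSpace Ω] {μ : Measure Ω}

/-- A centered Gaussian vector `X` and an independent Gaussian white noise `W` of variance `σ2`. -/
structure IsGaussianChannel (X W : ι → Ω → ℝ) (σ2 : ℝ≥0) (μ : Measure Ω) : Prop where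
  measurable_signal : ∀ i, Measurable (X i)
  measurable_noise : ∀ i, Measurable (W i)
  gaussian_signal : HasGaussianLaw (fun ω i ↦ X i ω) μ
  mean_signal : ∀ i, ∫ ω, X i ω ∂μ = 0
  noise_law : ∀ i, μ.map (W i) = gaussianReal 0 σ2
  noise_indep : iIndepFun W μ
  indep : IndepFun (fun ω i ↦ X i ω) (fun ω i ↦ W i ω) μ
  pos : σ2 ≠ 0

/-- Finite fourth moment, by Hölder with exponents 4, 4, 2. -/
theorem memLp_sq_div_sub_one_gaussianReal (σ2 : ℝ≥0) :
    MemLp (fun x : ℝ ↦ x ^ 2 / σ2 - 1) 2 (gaussianReal 0 σ2) := by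
  refine MemLp.sub ?_ (memLp_const 1)
  have h4 : MemLp (fun x : ℝ ↦ x) 4 (gaussianReal 0 σ2) := memLp_id_gaussianReal 4
  have : ENNReal.HolderTriple (4 : ℝ≥0∞) 4 2 := ⟨by
    rw [← ENNReal.toReal_eq_toReal_iff' (by simp) (by simp), ENNReal.toReal_add (by simp) (by simp)]
    norm_num⟩
  have h2 : MemLp (fun x : ℝ ↦ x * x) 2 (gaussianReal 0 σ2) := h4.mul h4
  simpa [pow_two, div_eq_mul_inv] using h2.mul_const (σ2 : ℝ)⁻¹

/-- The variance of the square of a standard Gaussian variable, computed at variance `σ2`. -/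
noncomputable def normalizedSquareVariance (σ2 : ℝ≥0) : ℝ :=
  Var[fun x : ℝ ↦ x ^ 2 / σ2 - 1; gaussianReal 0 σ2]

namespace IsGaussianChannel

variable {X W : ι → Ω → ℝ} {σ2 : ℝ≥0}

omit [Fintype ι] [DecidableEq ι] in
theorem gaussian_noise_apply (h : IsGaussianChannel X W σ2 μ) (i : ι) : HasGaussianLaw (W i) μ :=
  ⟨by rw [h.noise_law i]; infer_instance⟩

omit [DecidableEq ι] in
theorem gaussian_noise (h : IsGaussianChannel X W σ2 μ) : HasGaussianLaw (fun ω i ↦ W i ω) μ :=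
  iIndepFun.hasGaussianLaw h.gaussian_noise_apply h.noise_indep

omit [Fintype ι] [DecidableEq ι] in
theorem mean_noise (h : IsGaussianChannel X W σ2 μ) (i : ι) : ∫ ω, W i ω ∂μ = 0 := by
  have h1 : ∫ ω, W i ω ∂μ = ∫ x, x ∂(μ.map (W i)) :=
    (integral_map (h.measurable_noise i).aemeasurable aestronglyMeasurable_id).symm
  rw [h1, h.noise_law, integral_id_gaussianReal]

omit [Fintype ι] [DecidableEq ι] in
theorem second_moment_noise (h : IsGaussianChannel X W σ2 μ) (i : ι) :
    ∫ ω, W i ω * W i ω ∂μ = σ2 := by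
  have h1 : ∫ ω, W i ω * W i ω ∂μ = ∫ x, x ^ 2 ∂(μ.map (W i)) := by
    rw [integral_map (h.measurable_noise i).aemeasurable (by fun_prop)]
    simp only [pow_two]
  have h2 := variance_of_integral_eq_zero (μ := gaussianReal 0 σ2) (X := id) aemeasurable_id
    (by simp)
  rw [variance_id_gaussianReal] at h2
  rw [h1, h.noise_law, h2]
  rfl

omit [Fintype ι] in
theorem cov_noise (h : IsGaussianChannel X W σ2 μ) :
    Matrix.of (fun i j ↦ ∫ ω, W i ω * W j ω ∂μ) = (σ2 : ℝ) • (1 : Matrix ι ι ℝ) := by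
  ext i j
  rw [Matrix.of_apply, Matrix.smul_apply, Matrix.one_apply]
  split_ifs with hij
  · subst hij
    simp [h.second_moment_noise]
  · rw [(h.noise_indep.indepFun hij).integral_fun_mul_eq_mul_integral
      (h.measurable_noise i).aestronglyMeasurable (h.measurable_noise j).aestronglyMeasurable,
      h.mean_noise]
    simp

omit [Fintype ι] in
theorem cov_observation (h : IsGaussianChannel X W σ2 μ) :
    Matrix.of (fun i j ↦ ∫ ω, (X i ω + W i ω) * (X j ω + W j ω) ∂μ) =
      (σ2 : ℝ) • (1 + (σ2 : ℝ)⁻¹ • Matrix.of (fun i j ↦ ∫ ω, X i ω * X j ω ∂μ)) := by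
  have hσ : (σ2 : ℝ) ≠ 0 := by exact_mod_cast h.pos
  rw [smul_add, smul_smul, mul_inv_cancel₀ hσ, one_smul, ← h.cov_noise]
  ext i j
  simp only [Matrix.of_apply, Matrix.add_apply]
  have hX := fun i ↦ (h.gaussian_signal.eval i).memLp_two
  have hW := fun i ↦ (h.gaussian_noise_apply i).memLp_two
  have hXW : ∀ i j, ∫ ω, X i ω * W j ω ∂μ = 0 := fun i j ↦ by
    have hind : IndepFun (X i) (W j) μ :=
      h.indep.comp (measurable_pi_apply i) (measurable_pi_apply j)
    rw [hind.integral_fun_mul_eq_mul_integral (h.measurable_signal i).aestronglyMeasurable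
      (h.measurable_noise j).aestronglyMeasurable, h.mean_signal, zero_mul]
  have e : ∀ ω, (X i ω + W i ω) * (X j ω + W j ω) =
      (W i ω * W j ω + X i ω * X j ω) + (X i ω * W j ω + X j ω * W i ω) := fun ω ↦ by ring
  simp_rw [e]
  have i1 : Integrable (fun ω ↦ W i ω * W j ω) μ := (hW i).integrable_mul (hW j)
  have i2 : Integrable (fun ω ↦ X i ω * X j ω) μ := (hX i).integrable_mul (hX j)
  have i3 : Integrable (fun ω ↦ X i ω * W j ω) μ := (hX i).integrable_mul (hW j)
  have i4 : Integrable (fun ω ↦ X j ω * W i ω) μ := (hX j).integrable_mul (hW i)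
  rw [integral_add (i1.fun_add i2) (i3.fun_add i4), integral_add i1 i2, integral_add i3 i4,
    hXW, hXW]
  ring

variable {U : Matrix ι ι ℝ} {b : ι → ℝ}

theorem isDiagonalisedGaussian_noise (h : IsGaussianChannel X W σ2 μ) (hU : U * Uᵀ = 1) :
    IsDiagonalisedGaussian W U (fun _ ↦ σ2) μ where
  measurable := h.measurable_noise
  gaussian := h.gaussian_noise
  mean := h.mean_noise
  orthogonal := hU
  pos _ := h.pos
  cov := by
    rw [h.cov_noise, Matrix.mul_smul, Matrix.mul_one, Matrix.smul_mul, mul_eq_one_comm.1 hU,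
      Matrix.smul_one_eq_diagonal]

theorem isDiagonalisedGaussian_observation (h : IsGaussianChannel X W σ2 μ) (hU : U * Uᵀ = 1)
    (hB : (1 + (σ2 : ℝ)⁻¹ • Matrix.of (fun i j ↦ ∫ ω, X i ω * X j ω ∂μ)) * U = U * diagonal b)
    (hb : ∀ k, 1 ≤ b k) :
    IsDiagonalisedGaussian (fun i ω ↦ X i ω + W i ω) U (fun k ↦ σ2 * (b k).toNNReal) μ where
  measurable i := (h.measurable_signal i).add (h.measurable_noise i)
  gaussian := (h.indep.hasGaussianLaw h.gaussian_signal h.gaussian_noise).add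
  mean i := by
    rw [integral_add (h.gaussian_signal.eval i).integrable (h.gaussian_noise_apply i).integrable,
      h.mean_signal, h.mean_noise, add_zero]
  orthogonal := hU
  pos k := mul_ne_zero h.pos (by simpa using zero_lt_one.trans_le (hb k))
  cov := by
    rw [h.cov_observation, Matrix.mul_smul, Matrix.smul_mul, Matrix.mul_assoc, hB,
      ← Matrix.mul_assoc, mul_eq_one_comm.1 hU, Matrix.one_mul, ← Matrix.diagonal_smul]
    congr 1
    ext k
    simp [(zero_le_one.trans (hb k))]

omit [DecidableEq ι] in
-- The two arguments are kept separate because both uses need it: `w = y` for the likelihood ratio,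
-- and `w = y - x` for the mutual information.
theorem log_rotatedGaussianPDF_div (hσ : σ2 ≠ 0) (hb : ∀ k, 1 ≤ b k) (w y : ι → ℝ) :
    Real.log (rotatedGaussianPDF U (fun _ ↦ σ2) w /
      rotatedGaussianPDF U (fun k ↦ σ2 * (b k).toNNReal) y) =
      ∑ k, (1 / 2 * Real.log (b k) - (Uᵀ *ᵥ w) k ^ 2 / (2 * σ2) +
        (Uᵀ *ᵥ y) k ^ 2 / (2 * σ2 * b k)) := by
  have hb0 : ∀ k, 0 < b k := fun k ↦ zero_lt_one.trans_le (hb k)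
  have hs : ∀ k, σ2 * (b k).toNNReal ≠ 0 := fun k ↦ mul_ne_zero hσ (by simpa using hb0 k)
  rw [Real.log_div (rotatedGaussianPDF_pos U (fun _ ↦ hσ) w).ne'
    (rotatedGaussianPDF_pos U hs y).ne', log_rotatedGaussianPDF U (fun _ ↦ hσ),
    log_rotatedGaussianPDF U hs, ← Finset.sum_sub_distrib]
  refine Finset.sum_congr rfl fun k _ ↦ ?_
  have h0 : (0 : ℝ) < σ2 := by exact_mod_cast pos_iff_ne_zero.2 hσ
  have hpi := Real.pi_pos
  have := hb0 k
  rw [NNReal.coe_mul, Real.coe_toNNReal _ (hb0 k).le, ← mul_assoc (2 * Real.pi),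
    Real.log_mul (by positivity) (hb0 k).ne']
  ring

end IsGaussianChannel

section Density

variable [IsProbabilityMeasure μ] {V : ι → Ω → ℝ} {U : Matrix ι ι ℝ} {s : ι → ℝ≥0}

theorem IsDiagonalisedGaussian.map_absolutelyContinuous (h : IsDiagonalisedGaussian V U s μ) :
    μ.map (fun ω i ↦ V i ω) ≪ volume := by
  rw [h.map_eq]; exact withDensity_absolutelyContinuous _ _

theorem IsDiagonalisedGaussian.rnDeriv_toReal (h : IsDiagonalisedGaussian V U s μ) :
    ∀ᵐ y, ((μ.map fun ω i ↦ V i ω).rnDeriv volume y).toReal = rotatedGaussianPDF U s y := by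
  rw [h.map_eq]
  filter_upwards [Measure.rnDeriv_withDensity volume
    (measurable_rotatedGaussianPDF U s).ennreal_ofReal] with y hy
  rw [hy, ENNReal.toReal_ofReal (rotatedGaussianPDF_pos U h.pos y).le]

end Density

namespace IsGaussianChannel

variable {X W : ι → Ω → ℝ} {σ2 : ℝ≥0} {B : Matrix ι ι ℝ}

theorem gaussianInfo_eq_sum {U : Matrix ι ι ℝ} {b : ι → ℝ} (hU : U * Uᵀ = 1)
    (hBU : B * U = U * diagonal b) (hb : ∀ k, 1 ≤ b k) :
    gaussianInfo B = ∑ k, 1 / 2 * Real.log (b k) := by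
  have hUu : IsUnit U := (Matrix.isUnit_iff_isUnit_det _).2 (Matrix.isUnit_det_of_right_inverse hU)
  rw [gaussianInfo, det_of_similar_diagonal hUu hBU,
    Real.log_prod fun k _ ↦ (zero_lt_one.trans_le (hb k)).ne', Finset.mul_sum]

theorem gaussianKL_eq_sum {U : Matrix ι ι ℝ} {b : ι → ℝ} (hU : U * Uᵀ = 1)
    (hBU : B * U = U * diagonal b) (hb : ∀ k, 1 ≤ b k) :
    gaussianKL B = ∑ k, (1 / 2 * Real.log (b k) - 1 / 2 * (1 - (b k)⁻¹)) := by
  have hUu : IsUnit U := (Matrix.isUnit_iff_isUnit_det _).2 (Matrix.isUnit_det_of_right_inverse hU)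
  have h1 := gaussianInfo_eq_sum hU hBU hb
  rw [gaussianInfo] at h1
  rw [gaussianKL, h1, trace_of_similar_diagonal hUu (inv_mul_of_similar_diagonal hUu hBU
    fun k ↦ (zero_lt_one.trans_le (hb k)).ne'), Finset.sum_sub_distrib, ← Finset.mul_sum,
    ← Finset.mul_sum, Finset.sum_sub_distrib]
  simp

variable [IsProbabilityMeasure μ]

/-- `D` is `∑ (1 - 1 / b k) (z k ² / σ² - 1)`, where `z = Uᵀ W` has independent `N(0, σ²)`
coordinates because white noise is rotation invariant. The variances add up, and the weights lie in
`[0, 1)`. -/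
theorem exists_log_likelihood_eq (h : IsGaussianChannel X W σ2 μ)
    (hB : B = 1 + (σ2 : ℝ)⁻¹ • Matrix.of (fun i j ↦ ∫ ω, X i ω * X j ω ∂μ))
    (hBh : B.IsHermitian) (hB1 : (B - 1).PosSemidef) :
    ∃ D : Ω → ℝ, Measurable D ∧ Integrable (fun ω ↦ D ω ^ 2) μ ∧
      ∫ ω, D ω ^ 2 ∂μ ≤ normalizedSquareVariance σ2 * Fintype.card ι ∧
      ∀ᵐ ω ∂μ, Real.log (((μ.map fun ω i ↦ W i ω).rnDeriv volume fun i ↦ W i ω).toReal /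
        ((μ.map fun ω i ↦ X i ω + W i ω).rnDeriv volume fun i ↦ W i ω).toReal) =
        gaussianKL B - 1 / 2 * D ω := by
  obtain ⟨U, b, hU, hBU, hb⟩ := exists_orthogonal_diagonalisation hBh hB1
  have hW := h.isDiagonalisedGaussian_noise hU
  have hY := h.isDiagonalisedGaussian_observation hU (hB ▸ hBU) hb
  have hσ : (0 : ℝ) < σ2 := by exact_mod_cast pos_iff_ne_zero.2 h.pos
  set q : ℝ → ℝ := fun x ↦ x ^ 2 / σ2 - 1 with hq
  have hqm : Measurable q := by fun_prop
  set Q : ι → Ω → ℝ := fun k ω ↦ (1 - (b k)⁻¹) * q ((Uᵀ *ᵥ fun i ↦ W i ω) k) with hQ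
  have hqL : ∀ k, MemLp (fun ω ↦ q ((Uᵀ *ᵥ fun i ↦ W i ω) k)) 2 μ := fun k ↦ by
    have := memLp_sq_div_sub_one_gaussianReal σ2
    rw [← hW.map_rotate_apply k] at this
    exact this.comp_of_map (hW.measurable_rotate k).aemeasurable
  have hQL : ∀ k, MemLp (Q k) 2 μ := fun k ↦ (hqL k).const_mul _
  have hqvar : ∀ k, Var[fun ω ↦ q ((Uᵀ *ᵥ fun i ↦ W i ω) k); μ] = normalizedSquareVariance σ2 :=
    fun k ↦ by
      rw [normalizedSquareVariance, ← hW.map_rotate_apply k,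
        variance_map hqm.aemeasurable (hW.measurable_rotate k).aemeasurable]
      rfl
  have hqmean : ∀ k, ∫ ω, q ((Uᵀ *ᵥ fun i ↦ W i ω) k) ∂μ = 0 := fun k ↦ by
    have h1 := hW.integral_rotate_mul k k
    rw [if_pos rfl] at h1
    simp only [hq]
    rw [integral_sub _ (integrable_const 1), integral_div]
    · simp only [pow_two, h1, integral_const, probReal_univ, one_smul]
      rw [div_self hσ.ne', sub_self]
    · exact (hW.memLp_rotate k).integrable_sq.div_const _
  have hDL : MemLp (∑ k, Q k) 2 μ := memLp_finsetSum' _ fun k _ ↦ hQL k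
  have hDm : Measurable (∑ k, Q k) := by
    rw [Finset.sum_fn]
    exact Finset.measurable_sum _ fun k _ ↦ (hqm.comp (hW.measurable_rotate k)).const_mul _
  refine ⟨∑ k, Q k, hDm, hDL.integrable_sq, ?_, ?_⟩
  · have hmean : ∫ ω, (∑ k, Q k) ω ∂μ = 0 := by
      simp only [Finset.sum_apply]
      rw [integral_finsetSum _ fun k _ ↦ (hQL k).integrable one_le_two]
      simp [hQ, integral_const_mul, hqmean]
    have hvar := variance_of_integral_eq_zero hDm.aemeasurable hmean
    have hind : Set.Pairwise ((Finset.univ : Finset ι) : Set ι) fun i j ↦ IndepFun (Q i) (Q j) μ :=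
      fun i _ j _ hij ↦ (hW.iIndepFun_rotate.indepFun hij).comp (φ := fun x ↦ (1 - (b i)⁻¹) * q x)
        (ψ := fun x ↦ (1 - (b j)⁻¹) * q x) (hqm.const_mul _) (hqm.const_mul _)
    have hsum := IndepFun.variance_sum (s := Finset.univ) (fun i _ ↦ hQL i) hind
    have h1 : ∫ ω, (∑ k, Q k) ω ^ 2 ∂μ = ∑ k, Var[Q k; μ] := by rw [← hsum, hvar]
    rw [h1]
    calc ∑ k, Var[Q k; μ] ≤ ∑ _k : ι, normalizedSquareVariance σ2 := by
          refine Finset.sum_le_sum fun k _ ↦ ?_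
          rw [hQ, variance_const_mul, hqvar]
          have hb0 : 0 < (b k)⁻¹ := inv_pos.2 (zero_lt_one.trans_le (hb k))
          have hb1 : (b k)⁻¹ ≤ 1 := inv_le_one_of_one_le₀ (hb k)
          refine mul_le_of_le_one_left (variance_nonneg _ _) ?_
          nlinarith
      _ = _ := by simp [mul_comm]
  -- The densities are identified Lebesgue-almost everywhere; both identities hold along `W` because
  -- its law is absolutely continuous.
  · filter_upwards [ae_of_ae_map (measurable_pi_lambda _ hW.measurable).aemeasurable
        (hW.map_absolutelyContinuous.ae_le hW.rnDeriv_toReal),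
      ae_of_ae_map (measurable_pi_lambda _ hW.measurable).aemeasurable
        (hW.map_absolutelyContinuous.ae_le hY.rnDeriv_toReal)] with ω h1 h2
    rw [h1, h2, log_rotatedGaussianPDF_div h.pos hb, gaussianKL_eq_sum hU hBU hb,
      Finset.sum_apply, Finset.mul_sum, ← Finset.sum_sub_distrib]
    refine Finset.sum_congr rfl fun k _ ↦ ?_
    simp only [hQ, hq]
    have := zero_lt_one.trans_le (hb k)
    field_simp
    ring

/-- The shear `(x, w) ↦ (x, x + w)` preserves the product of the signal law with Lebesgue measure.
The signal law itself may be singular. -/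
theorem map_pair_eq_withDensity (h : IsGaussianChannel X W σ2 μ) {U : Matrix ι ι ℝ}
    (hU : U * Uᵀ = 1) :
    μ.map (fun ω ↦ ((fun i ↦ X i ω), fun i ↦ X i ω + W i ω)) =
      ((μ.map fun ω i ↦ X i ω).prod volume).withDensity fun z ↦
        ENNReal.ofReal (rotatedGaussianPDF U (fun _ ↦ σ2) (-z.1 + z.2)) := by
  have hXm : Measurable fun ω i ↦ X i ω := measurable_pi_lambda _ h.measurable_signal
  have hWm : Measurable fun ω i ↦ W i ω := measurable_pi_lambda _ h.measurable_noise
  have : IsProbabilityMeasure (μ.map fun ω i ↦ X i ω) :=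
    Measure.isProbabilityMeasure_map hXm.aemeasurable
  have hprod := (indepFun_iff_map_prod_eq_prod_map_map hXm.aemeasurable hWm.aemeasurable).1 h.indep
  have hf := (measurable_rotatedGaussianPDF U (fun _ : ι ↦ σ2)).ennreal_ofReal
  rw [(h.isDiagonalisedGaussian_noise hU).map_eq, prod_withDensity_right hf] at hprod
  have hg : Measurable fun z : (ι → ℝ) × (ι → ℝ) ↦
      ENNReal.ofReal (rotatedGaussianPDF U (fun _ ↦ σ2) (-z.1 + z.2)) :=
    hf.comp (measurable_fst.neg.add measurable_snd)
  rw [← map_withDensity_comp (MeasurableEquiv.shearAddRight (ι → ℝ))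
    (measurePreserving_prod_add (μ.map fun ω i ↦ X i ω) volume) hg]
  have hcomp : (fun z : (ι → ℝ) × (ι → ℝ) ↦
      ENNReal.ofReal (rotatedGaussianPDF U (fun _ ↦ σ2) (-z.1 + z.2))) ∘
        (MeasurableEquiv.shearAddRight (ι → ℝ)) =
      fun z ↦ ENNReal.ofReal (rotatedGaussianPDF U (fun _ ↦ σ2) z.2) := by
    ext1 z
    change ENNReal.ofReal (rotatedGaussianPDF U (fun _ ↦ σ2) (-z.1 + (z.1 + z.2))) = _
    rw [neg_add_cancel_left]
  rw [hcomp, ← hprod, Measure.map_map (MeasurableEquiv.measurable _) (hXm.prodMk hWm)]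
  rfl

/-- The log density is a sum of `½ log (b k)` and two quadratic terms. Their means are `-½` and `½`,
as the rotated noise and observation have variances `σ²` and `σ² b k`, so only the logarithms
survive. -/
theorem klDiv_eq (h : IsGaussianChannel X W σ2 μ)
    (hB : B = 1 + (σ2 : ℝ)⁻¹ • Matrix.of (fun i j ↦ ∫ ω, X i ω * X j ω ∂μ))
    (hBh : B.IsHermitian) (hB1 : (B - 1).PosSemidef) :
    klDiv (μ.map fun ω ↦ ((fun i ↦ X i ω), fun i ↦ X i ω + W i ω))
      ((μ.map fun ω i ↦ X i ω).prod (μ.map fun ω i ↦ X i ω + W i ω)) ≠ ∞ ∧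
    (klDiv (μ.map fun ω ↦ ((fun i ↦ X i ω), fun i ↦ X i ω + W i ω))
      ((μ.map fun ω i ↦ X i ω).prod (μ.map fun ω i ↦ X i ω + W i ω))).toReal = gaussianInfo B := by
  obtain ⟨U, b, hU, hBU, hb⟩ := exists_orthogonal_diagonalisation hBh hB1
  have hW := h.isDiagonalisedGaussian_noise hU
  have hY := h.isDiagonalisedGaussian_observation hU (hB ▸ hBU) hb
  have hσ : (0 : ℝ) < σ2 := by exact_mod_cast pos_iff_ne_zero.2 h.pos
  have hXm : Measurable fun ω i ↦ X i ω := measurable_pi_lambda _ h.measurable_signal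
  have hYm : Measurable fun ω i ↦ X i ω + W i ω := measurable_pi_lambda _ hY.measurable
  set PX := μ.map fun ω i ↦ X i ω with hPX
  set PY := μ.map fun ω i ↦ X i ω + W i ω with hPY
  set J := μ.map fun ω ↦ ((fun i ↦ X i ω), fun i ↦ X i ω + W i ω) with hJ
  have : IsProbabilityMeasure PX := Measure.isProbabilityMeasure_map hXm.aemeasurable
  have : IsProbabilityMeasure PY := Measure.isProbabilityMeasure_map hYm.aemeasurable
  have : IsProbabilityMeasure J := Measure.isProbabilityMeasure_map (hXm.prodMk hYm).aemeasurable
  set s : ι → ℝ≥0 := fun k ↦ σ2 * (b k).toNNReal with hs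
  have hGpos : ∀ y, 0 < rotatedGaussianPDF U s y := rotatedGaussianPDF_pos U hY.pos
  have hFpos : ∀ y, 0 < rotatedGaussianPDF U (fun _ : ι ↦ σ2) y := rotatedGaussianPDF_pos U hW.pos
  have hGm := measurable_rotatedGaussianPDF U s
  have hFm := measurable_rotatedGaussianPDF U (fun _ : ι ↦ σ2)
  set R : (ι → ℝ) × (ι → ℝ) → ℝ := fun z ↦
    rotatedGaussianPDF U (fun _ ↦ σ2) (-z.1 + z.2) / rotatedGaussianPDF U s z.2 with hR
  have hRm : Measurable R :=
    (hFm.comp (measurable_fst.neg.add measurable_snd)).div (hGm.comp measurable_snd)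
  have hG2 : Measurable fun z : (ι → ℝ) × (ι → ℝ) ↦
      ENNReal.ofReal (rotatedGaussianPDF U s z.2) := hGm.ennreal_ofReal.comp measurable_snd
  -- Joint and product law both have densities against `PX ⊗ volume`; positivity of the observation
  -- density permits the division.
  have hJR : J = (PX.prod PY).withDensity fun z ↦ ENNReal.ofReal (R z) := by
    rw [hJ, h.map_pair_eq_withDensity hU, hPY, hY.map_eq, prod_withDensity_right hGm.ennreal_ofReal,
      ← withDensity_mul _ hG2 hRm.ennreal_ofReal]
    congr 1
    ext1 z
    rw [Pi.mul_apply, ← ENNReal.ofReal_mul (hGpos _).le, hR]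
    simp only
    rw [mul_div_cancel₀ _ (hGpos z.2).ne']
  have hac : J ≪ PX.prod PY := by rw [hJR]; exact withDensity_absolutelyContinuous _ _
  have hllr : llr J (PX.prod PY) =ᵐ[J] fun z ↦ Real.log (R z) := by
    have := Measure.rnDeriv_withDensity (PX.prod PY) hRm.ennreal_ofReal
    rw [← hJR] at this
    filter_upwards [hac.ae_le this] with z hz
    rw [llr_def]
    simp only
    rw [hz, ENNReal.toReal_ofReal (div_pos (hFpos _) (hGpos _)).le]
  have hlog : ∀ ω, Real.log (R ((fun i ↦ X i ω), fun i ↦ X i ω + W i ω)) =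
      ∑ k, (1 / 2 * Real.log (b k) - (Uᵀ *ᵥ fun i ↦ W i ω) k ^ 2 / (2 * σ2) +
        (Uᵀ *ᵥ fun i ↦ X i ω + W i ω) k ^ 2 / (2 * σ2 * b k)) := fun ω ↦ by
    have e : (-(fun i ↦ X i ω) + fun i ↦ X i ω + W i ω) = fun i ↦ W i ω := by
      ext i; simp
    simp only [hR]
    rw [e, log_rotatedGaussianPDF_div h.pos hb]
  have hi1 : ∀ k, Integrable (fun ω ↦ (Uᵀ *ᵥ fun i ↦ W i ω) k ^ 2 / (2 * σ2)) μ := fun k ↦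
    (hW.memLp_rotate k).integrable_sq.div_const _
  have hi2 : ∀ k, Integrable (fun ω ↦ (Uᵀ *ᵥ fun i ↦ X i ω + W i ω) k ^ 2 / (2 * σ2 * b k)) μ :=
    fun k ↦ (hY.memLp_rotate k).integrable_sq.div_const _
  have hi3 : ∀ k, Integrable (fun ω ↦ 1 / 2 * Real.log (b k) -
      (Uᵀ *ᵥ fun i ↦ W i ω) k ^ 2 / (2 * σ2) +
        (Uᵀ *ᵥ fun i ↦ X i ω + W i ω) k ^ 2 / (2 * σ2 * b k)) μ := fun k ↦
    ((integrable_const _).sub (hi1 k)).add (hi2 k)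
  have hint : Integrable (llr J (PX.prod PY)) J := by
    rw [integrable_congr hllr, hJ, integrable_map_measure hRm.log.aestronglyMeasurable
      (hXm.prodMk hYm).aemeasurable]
    simp only [Function.comp_def, hlog]
    exact integrable_finsetSum _ fun k _ ↦ hi3 k
  refine ⟨klDiv_ne_top hac hint, ?_⟩
  rw [toReal_klDiv_of_measure_eq hac (by simp), integral_congr_ae hllr, hJ,
    integral_map (hXm.prodMk hYm).aemeasurable hRm.log.aestronglyMeasurable]
  simp only [hlog]
  rw [integral_finsetSum _ fun k _ ↦ hi3 k, gaussianInfo_eq_sum hU hBU hb]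
  refine Finset.sum_congr rfl fun k _ ↦ ?_
  have hb0 := zero_lt_one.trans_le (hb k)
  have hi0 : Integrable (fun ω ↦ 1 / 2 * Real.log (b k) -
      (Uᵀ *ᵥ fun i ↦ W i ω) k ^ 2 / (2 * σ2)) μ := (integrable_const _).sub (hi1 k)
  rw [integral_add hi0 (hi2 k), integral_sub (integrable_const _) (hi1 k), integral_div,
    integral_div]
  have e1 := hW.integral_rotate_mul k k
  have e2 := hY.integral_rotate_mul k k
  rw [if_pos rfl] at e1 e2
  simp only [pow_two, e1, e2, integral_const, probReal_univ, one_smul]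
  rw [NNReal.coe_mul, Real.coe_toNNReal _ hb0.le]
  field_simp
  ring

end IsGaussianChannel

end GaussianChannel

/-! ### Almost sure convergence and the two rates -/

section Rates

open Matrix

variable {Ω : Type*} [mΩ : MeasurableSpace Ω] {μ : Measure Ω}

/-- The scaled second moments are at most `c / n²`, so the squares are almost surely summable.
Nothing is required of the joint law of the `D n`, whose eigenbases vary with `n`. -/
theorem ae_tendsto_zero_of_integral_sq_le {D : ℕ → Ω → ℝ} {c : ℝ} (hm : ∀ n, Measurable (D n))
    (hi : ∀ n, Integrable (fun ω ↦ D n ω ^ 2) μ)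
    (hD : ∀ n, ∫ ω, D n ω ^ 2 ∂μ ≤ c * (n * n : ℕ)) :
    ∀ᵐ ω ∂μ, Tendsto (fun n : ℕ ↦ 1 / (n : ℝ) ^ 2 * D n ω) atTop (𝓝 0) := by
  have hc : 0 ≤ c := by
    have := (integral_nonneg fun ω ↦ sq_nonneg (D 1 ω)).trans (hD 1)
    simpa using this
  have hmeas : ∀ n : ℕ, Measurable fun ω ↦ ENNReal.ofReal ((1 / (n : ℝ) ^ 2 * D n ω) ^ 2) :=
    fun n ↦ (((hm n).const_mul _).pow_const 2).ennreal_ofReal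
  have hbound : ∀ n : ℕ, ∫⁻ ω, ENNReal.ofReal ((1 / (n : ℝ) ^ 2 * D n ω) ^ 2) ∂μ ≤
      ENNReal.ofReal (c * (1 / (n : ℝ) ^ 2)) := by
    intro n
    simp only [mul_pow]
    rw [← ofReal_integral_eq_lintegral_ofReal ((hi n).const_mul _)
      (.of_forall fun ω ↦ by positivity), integral_const_mul]
    refine ENNReal.ofReal_le_ofReal ?_
    -- At `n = 0` the factor `1 / 0 ^ 2` is 0 and both sides vanish.
    rcases Nat.eq_zero_or_pos n with rfl | hn
    · simp
    · have hn' : (0 : ℝ) < n := by exact_mod_cast hn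
      calc (1 / (n : ℝ) ^ 2) ^ 2 * ∫ ω, D n ω ^ 2 ∂μ ≤ (1 / (n : ℝ) ^ 2) ^ 2 * (c * (n * n : ℕ)) :=
            mul_le_mul_of_nonneg_left (hD n) (by positivity)
        _ = _ := by push_cast; field_simp
  have hsum : Summable fun n : ℕ ↦ c * (1 / (n : ℝ) ^ 2) :=
    (Real.summable_one_div_nat_pow.2 one_lt_two).mul_left c
  have hfin : ∫⁻ ω, ∑' n : ℕ, ENNReal.ofReal ((1 / (n : ℝ) ^ 2 * D n ω) ^ 2) ∂μ ≠ ∞ := by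
    rw [lintegral_tsum fun n ↦ (hmeas n).aemeasurable]
    refine ne_top_of_le_ne_top ?_ (ENNReal.tsum_le_tsum hbound)
    rw [← ENNReal.ofReal_tsum_of_nonneg (fun n ↦ by positivity) hsum]
    exact ENNReal.ofReal_ne_top
  filter_upwards [ae_lt_top (.tsum hmeas) hfin] with ω hω
  have h := ENNReal.tendsto_atTop_zero_of_tsum_ne_top hω.ne
  have h2 := (ENNReal.tendsto_toReal ENNReal.zero_ne_top).comp h
  simp only [Function.comp_def, ENNReal.toReal_zero,
    ENNReal.toReal_ofReal (sq_nonneg _)] at h2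
  have h3 := h2.sqrt
  simp only [Real.sqrt_sq_eq_abs, Real.sqrt_zero] at h3
  exact (tendsto_zero_iff_abs_tendsto_zero _).2 h3

variable {X W : LatticeField Ω} {σ2 : ℝ≥0}

theorem IsStationaryGaussianField.hasGaussianLaw_box (hX : IsStationaryGaussianField X μ) (n : ℕ) :
    HasGaussianLaw (fun ω (p : Fin n × Fin n) ↦ X (boxNode p) ω) μ := by
  let L : (↥(Finset.univ : Finset (Fin n × Fin n)) → ℝ) →L[ℝ] (Fin n × Fin n → ℝ) :=
    ContinuousLinearMap.pi fun p ↦ ContinuousLinearMap.proj ⟨p, Finset.mem_univ p⟩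
  exact ((hX.gaussian.comp_right (boxNode (n := n))).hasGaussianLaw Finset.univ).map L

theorem measurable_boxRestrict (n : ℕ) : Measurable (boxRestrict n) :=
  measurable_pi_lambda _ fun _ ↦ measurable_pi_apply _

theorem measurable_fieldConfig (hX : ∀ i, Measurable (X i)) : Measurable (fieldConfig X) :=
  measurable_pi_lambda _ hX

theorem isGaussianChannel_box (hX : IsStationaryGaussianField X μ) (hσ : 0 < σ2)
    (hWm : ∀ i, Measurable (W i)) (hWl : ∀ i, HasLaw (W i) (gaussianReal 0 σ2) μ)
    (hWi : iIndepFun W μ) (hXW : IndepFun (fieldConfig X) (fieldConfig W) μ) (n : ℕ) :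
    IsGaussianChannel (fun p : Fin n × Fin n ↦ X (boxNode p)) (fun p ↦ W (boxNode p)) σ2 μ where
  measurable_signal _ := hX.measurable _
  measurable_noise _ := hWm _
  gaussian_signal := hX.hasGaussianLaw_box n
  mean_signal _ := hX.zero_mean _
  noise_law _ := (hWl _).map_eq
  noise_indep := hWi.precomp boxNode_injective
  indep := hXW.comp (measurable_boxRestrict n) (measurable_boxRestrict n)
  pos := hσ.ne'

variable [IsProbabilityMeasure μ]

theorem hasKLIRate_of_tendsto (hX : IsStationaryGaussianField X μ) (hσ : 0 < σ2)
    (hWm : ∀ i, Measurable (W i)) (hWl : ∀ i, HasLaw (W i) (gaussianReal 0 σ2) μ)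
    (hWi : iIndepFun W μ) (hXW : IndepFun (fieldConfig X) (fieldConfig W) μ) {r : ℝ}
    (hr : Tendsto (fun n : ℕ ↦ 1 / (n : ℝ) ^ 2 *
      gaussianKL (1 + (σ2 : ℝ)⁻¹ • boxMatrix (fieldCov X μ) n)) atTop (𝓝 r)) :
    HasKLIRate (μ.map (fieldConfig W)) (μ.map (fieldConfig (fun i ω ↦ X i ω + W i ω))) r := by
  have hYm : ∀ i, Measurable fun ω ↦ X i ω + W i ω := fun i ↦ (hX.measurable i).add (hWm i)
  have hc : 0 ≤ (σ2 : ℝ)⁻¹ := by positivity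
  have hD := fun n ↦ (isGaussianChannel_box hX hσ hWm hWl hWi hXW n).exists_log_likelihood_eq
    (B := 1 + (σ2 : ℝ)⁻¹ • boxMatrix (fieldCov X μ) n) rfl
    (posDef_one_add_smul (hX.boxMatrix_posSemidef n) hc).isHermitian
    (posSemidef_one_add_smul_sub_one (hX.boxMatrix_posSemidef n) hc)
  choose D hDm hDi hDv hDl using hD
  have hD0 := ae_tendsto_zero_of_integral_sq_le hDm hDi (c := normalizedSquareVariance σ2)
    fun n ↦ by simpa using hDv n
  have hmeas : ∀ (Q : Measure (ℤ × ℤ → ℝ)) (n : ℕ),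
      Measurable fun y ↦ boxDensity Q n (boxRestrict n y) := fun Q n ↦
    (Measure.measurable_rnDeriv _ _).ennreal_toReal.comp (measurable_boxRestrict n)
  -- Measurability of the convergence set allows the statement to be moved from the law of `W` back
  -- to `μ`.
  have hset : MeasurableSet {y | Tendsto (fun n : ℕ ↦ 1 / (n : ℝ) ^ 2 *
      Real.log (boxDensity (μ.map (fieldConfig W)) n (boxRestrict n y) /
        boxDensity (μ.map (fieldConfig fun i ω ↦ X i ω + W i ω)) n (boxRestrict n y)))
      atTop (𝓝 r)} :=
    measurableSet_tendsto _ fun n ↦ ((hmeas _ n).div (hmeas _ n)).log.const_mul _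
  refine (ae_map_iff (measurable_fieldConfig hWm).aemeasurable hset).2 ?_
  filter_upwards [hD0, ae_all_iff.2 hDl] with ω h1 h2
  have h3 := hr.sub (h1.const_mul (1 / 2))
  rw [mul_zero, sub_zero] at h3
  refine h3.congr fun n ↦ ?_
  rw [boxDensity, boxDensity, Measure.map_map (measurable_boxRestrict n) (measurable_fieldConfig hWm),
    Measure.map_map (measurable_boxRestrict n) (measurable_fieldConfig hYm)]
  change _ = 1 / (n : ℝ) ^ 2 * Real.log
    (((μ.map fun ω (p : Fin n × Fin n) ↦ W (boxNode p) ω).rnDeriv volume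
      fun p ↦ W (boxNode p) ω).toReal /
    ((μ.map fun ω (p : Fin n × Fin n) ↦ X (boxNode p) ω + W (boxNode p) ω).rnDeriv volume
      fun p ↦ W (boxNode p) ω).toReal)
  rw [h2 n]
  ring

theorem hasMIRate_of_tendsto (hX : IsStationaryGaussianField X μ) (hσ : 0 < σ2)
    (hWm : ∀ i, Measurable (W i)) (hWl : ∀ i, HasLaw (W i) (gaussianReal 0 σ2) μ)
    (hWi : iIndepFun W μ) (hXW : IndepFun (fieldConfig X) (fieldConfig W) μ) {r : ℝ}
    (hr : Tendsto (fun n : ℕ ↦ 1 / (n : ℝ) ^ 2 *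
      gaussianInfo (1 + (σ2 : ℝ)⁻¹ • boxMatrix (fieldCov X μ) n)) atTop (𝓝 r)) :
    HasMIRate X (fun i ω ↦ X i ω + W i ω) μ r := by
  have hc : 0 ≤ (σ2 : ℝ)⁻¹ := by positivity
  have hkl := fun n ↦ (isGaussianChannel_box hX hσ hWm hWl hWi hXW n).klDiv_eq
    (B := 1 + (σ2 : ℝ)⁻¹ • boxMatrix (fieldCov X μ) n) rfl
    (posDef_one_add_smul (hX.boxMatrix_posSemidef n) hc).isHermitian
    (posSemidef_one_add_smul_sub_one (hX.boxMatrix_posSemidef n) hc)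
  refine ⟨fun n ↦ (hkl n).1, hr.congr fun n ↦ ?_⟩
  rw [← (hkl n).2]
  rfl

end Rates

theorem corollary2 {Ω : Type*} [MeasurableSpace Ω] (μ : Measure Ω) [IsProbabilityMeasure μ]
    (X W : LatticeField Ω) (ζ : ℝ) (σ2 : ℝ≥0) (hσ : 0 < σ2)
    (hmodel : IsHiddenSFCAR X W ζ σ2 μ) :
    HasKLIRate (μ.map (fieldConfig W)) (μ.map (fieldConfig (fun i ω ↦ X i ω + W i ω)))
      (1 / (4 * Real.pi ^ 2) * ∫ ω₁ in (-Real.pi)..Real.pi, ∫ ω₂ in (-Real.pi)..Real.pi,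
        (1 / 2 * Real.log (1 + snrQuotient (signalToNoise X W μ) ζ ω₁ ω₂) -
          1 / 2 * (1 - 1 / (1 + snrQuotient (signalToNoise X W μ) ζ ω₁ ω₂)))) ∧
    HasMIRate X (fun i ω ↦ X i ω + W i ω) μ
      (1 / (4 * Real.pi ^ 2) * ∫ ω₁ in (-Real.pi)..Real.pi, ∫ ω₂ in (-Real.pi)..Real.pi,
        1 / 2 * Real.log (1 + snrQuotient (signalToNoise X W μ) ζ ω₁ ω₂)) := by
  obtain ⟨hsignal, hWm, hWl, hWi, hXW⟩ := hmodel
  have hσ' : (0 : ℝ) < σ2 := hσ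
  have hc : 0 ≤ (σ2 : ℝ)⁻¹ := by positivity
  rcases hsignal with ⟨κ, lam, hκ, hlam, hlt, rfl, hX⟩ | ⟨rfl, hX⟩
  · have h0 : 0 ≤ lam / κ := by positivity
    have h1 : lam / κ < 1 / 4 := by rw [div_lt_iff₀ hκ]; linarith
    set v := ∫ ω, X (0, 0) ω ^ 2 ∂μ with hv
    have hC := hX.fieldCov_eq
    have hle : ∀ p q, |fieldCov X μ p q| ≤ v := hX.field.abs_fieldCov_le
    have hpsd := hX.field.boxMatrix_posSemidef
    have hve := variance_eq_ellipticK h0 h1 hκ hle hX.field.fieldCov_self hC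
    have hsnr : signalToNoise X W μ = v / σ2 := by
      -- The box with one node already contains the origin, which is enough for the noise power.
      have hch := isGaussianChannel_box hX.field hσ hWm hWl hWi hXW 1
      have := hch.second_moment_noise (0, 0)
      rw [signalToNoise, hv, ← this]
      simp only [pow_two]
      rfl
    simp only [hsnr, snrQuotient_eq h0 h1 hκ hσ' hve]
    exact ⟨hasKLIRate_of_tendsto hX.field hσ hWm hWl hWi hXW
        (tendsto_gaussianKL_boxMatrix h0 h1 hκ hle hpsd hC hc),
      hasMIRate_of_tendsto hX.field hσ hWm hWl hWi hXW
        (tendsto_gaussianInfo_boxMatrix h0 h1 hκ hle hpsd hC hc)⟩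
  · have hC : ∀ p q, fieldCov X μ p q = ∫ ω, X (0, 0) ω ^ 2 ∂μ := fun p q ↦ by
      refine integral_congr_ae ?_
      filter_upwards [hX.eq p (0, 0), hX.eq q (0, 0)] with ω h1 h2
      rw [h1, h2, pow_two]
    have hv : 0 ≤ ∫ ω, X (0, 0) ω ^ 2 ∂μ := integral_nonneg fun ω ↦ sq_nonneg _
    simp only [snrQuotient_one_fourth]
    constructor
    · convert hasKLIRate_of_tendsto hX.field hσ hWm hWl hWi hXW
        (tendsto_gaussianKL_boxMatrix_const hC hv hc hX.field.boxMatrix_posSemidef) using 1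
      simp
    · convert hasMIRate_of_tendsto hX.field hσ hWm hWl hWi hXW
        (tendsto_gaussianInfo_boxMatrix_const hC hv hc) using 1
      simp
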